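/- Let $d\ge 3$ be an integer, $p\in(d,\infty)$, and write $s_r:=-1+\frac dr$. Fix a non-negative radial $\varphi\in C^\infty(\mathbb R^d)$ supported in $\{\frac34\le|\xi|\le\frac83\}$ with $\sum_{j\in\mathbb Z}\varphi(2^{-j}\xi)=1$ for $\xi\ne0$, and put $\dot\Delta_jf=\varphi(2^{-j}D)f$ for tempered distributions $f$ on $\mathbb R^d$ with values in $\mathbb R^d$. For $r,q\in[1,\infty]$ and $s<d/r$, the space $\dot B^{s}_{r,q}(\mathbb R^d)$ consists of those $f$ for which $\|f\|_{\dot B^s_{r,q}}:=\big\|(2^{js}\|\dot\Delta_jf\|_{L^r})_{j\in\mathbb Z}\big\|_{\ell^q}<\infty$ and $\sum_{j\in\mathbb Z}\dot\Delta_jf=f$ in the sense of tempered distributions. There exist $p_2\in(p,\infty)$, $\delta_2\in(0,-s_{p_2})$, $\gamma_1,\gamma_2>0$, each depending only on $d$ and $p$, and $C>0$, depending only on $d$, $p$ and $\varphi$, such that for each divergence-free vector field $g\in\dot B^{s_p}_{p,\infty}(\mathbb R^d)$ and each $N>0$ there exist divergence-free vector fields $\bar g^N\in\dot B^{s_{p_2}+\delta_2}_{p_2,p_2}(\mathbb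 R^d)\cap\dot B^{s_p}_{p,\infty}(\mathbb R^d)$ and $\tilde g^N\in L^2(\mathbb R^d)\cap\dot B^{s_p}_{p,\infty}(\mathbb R^d)$ with $$g=\tilde g^N+\bar g^N,$$ $$\|\tilde g^N\|_{L^2}\le CN^{-\gamma_2}\|g\|_{\dot B^{s_p}_{p,\infty}},\qquad \|\bar g^N\|_{\dot B^{s_{p_2}+\delta_2}_{p_2,p_2}}\le CN^{\gamma_1}\|g\|_{\dot B^{s_p}_{p,\infty}},$$ and $$\|\tilde g^N\|_{\dot B^{s_p}_{p,\infty}},\ \|\bar g^N\|_{\dot B^{s_p}_{p,\infty}}\le C\|g\|_{\dot B^{s_p}_{p,\infty}}.$$ -/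

import Mathlib

open scoped SchwartzMap ENNReal LineDeriv

noncomputable section

/-- Tempered distributions on `ℝ^d` with values in `ℂ^d`; the `ℝ^d`-valued ones are singled out by
`IsRealValued`. -/
abbrev VectorDistribution (d : ℕ) : Type :=
  𝓢'(EuclideanSpace ℝ (Fin d), EuclideanSpace ℂ (Fin d))

/-- The distribution takes values in `ℝ^d`: every component is real on real test functions. -/
def IsRealValued {d : ℕ} (f : VectorDistribution d) : Prop :=
  ∀ u : 𝓢(EuclideanSpace ℝ (Fin d), ℂ), (∀ x, (u x).im = 0) → ∀ i, (f u i).im = 0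

/-- `div f = ∑ᵢ ∂ᵢ fᵢ = 0` in the sense of distributions. -/
def IsDivFree {d : ℕ} (f : VectorDistribution d) : Prop :=
  ∀ u : 𝓢(EuclideanSpace ℝ (Fin d), ℂ),
    ∑ i : Fin d, (∂_{EuclideanSpace.single i (1 : ℝ)} f) u i = 0

/-- A smooth, non-negative, radial function supported in `3/4 ≤ |ξ| ≤ 8/3` whose dyadic dilates sum
to one away from the origin. -/
structure IsLittlewoodPaley {d : ℕ} (φ : EuclideanSpace ℝ (Fin d) → ℝ) : Prop where
  smooth : ContDiff ℝ (⊤ : ℕ∞) φ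
  nonneg : ∀ ξ, 0 ≤ φ ξ
  radial : ∀ ξ η, ‖ξ‖ = ‖η‖ → φ ξ = φ η
  support : ∀ ξ, φ ξ ≠ 0 → 3 / 4 ≤ ‖ξ‖ ∧ ‖ξ‖ ≤ 8 / 3
  partition : ∀ ξ, ξ ≠ 0 → HasSum (fun j : ℤ => φ ((2 : ℝ) ^ (-j) • ξ)) 1

/-- The Littlewood–Paley projector `Δ_j f = φ(2⁻ʲ D) f` with `D = -i∇`. Mathlib's Fourier transform
uses the character `exp (-2πi x·ξ)`, so `D` has the symbol `2π ξ`. -/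
def lpProj {d : ℕ} (φ : EuclideanSpace ℝ (Fin d) → ℝ) (j : ℤ) (f : VectorDistribution d) :
    VectorDistribution d :=
  TemperedDistribution.fourierMultiplierCLM (EuclideanSpace ℂ (Fin d))
    (fun ξ => (φ ((2 : ℝ) ^ (-j) • (2 * Real.pi) • ξ) : ℂ)) f

/-- The `L^p` norm (`1 ≤ p ≤ ∞`) of a distribution: the norm of the `L^p` function that represents
it, and `∞` if there is none. -/
def distLpNorm {d : ℕ} (p : ℝ≥0∞) (f : VectorDistribution d) : ℝ≥0∞ :=
  ⨅ (F : EuclideanSpace ℝ (Fin d) → EuclideanSpace ℂ (Fin d))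
    (_ : MeasureTheory.MemLp F p MeasureTheory.volume)
    (_ : ∀ u : 𝓢(EuclideanSpace ℝ (Fin d), ℂ), f u = ∫ x, u x • F x),
    MeasureTheory.eLpNorm F p MeasureTheory.volume

/-- The `ℓ^q(ℤ)` norm (`0 < q ≤ ∞`) of a sequence in `[0, ∞]`. -/
def seqNorm (q : ℝ≥0∞) (a : ℤ → ℝ≥0∞) : ℝ≥0∞ :=
  if q = ∞ then ⨆ j, a j else (∑' j, a j ^ q.toReal) ^ (1 / q.toReal)

/-- The homogeneous Besov norm of `Ḃ^s_{p,q}`. -/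
def besovNorm {d : ℕ} (φ : EuclideanSpace ℝ (Fin d) → ℝ) (s : ℝ) (p q : ℝ≥0∞)
    (f : VectorDistribution d) : ℝ≥0∞ :=
  seqNorm q fun j => ENNReal.ofReal ((2 : ℝ) ^ ((j : ℝ) * s)) * distLpNorm p (lpProj φ j f)

/-- Membership in `Ḃ^s_{p,q}` for `s < d/p`: the norm is finite and `∑_j Δ_j f` converges to `f` in
the space of tempered distributions. -/
def MemBesov {d : ℕ} (φ : EuclideanSpace ℝ (Fin d) → ℝ) (s : ℝ) (p q : ℝ≥0∞)
    (f : VectorDistribution d) : Prop :=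
  besovNorm φ s p q f < ∞ ∧ HasSum (fun j : ℤ => lpProj φ j f) f

/-- The critical regularity `s_p = -1 + d/p`. -/
def critReg (d : ℕ) (p : ℝ) : ℝ := -1 + d / p

end

/-! Write M for the critical norm of g, so that ‖Δ_j g‖_p ≤ 2^{-j s_p} M, and fix a threshold
frequency 2^J. Blocks with j < J go entirely to the regular part. Bernstein's inequality and
interpolation between L^p and L^∞ bound them in L^{2p}, and an extra regularity δ = 1/(8p) makes
their weighted norms decay like 2^{δj} as j → -∞.

A block with j ≥ J is cut at a height l. Its large values lie in L^2 with norm at most l^{1-p/2}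
‖Δ_j g‖_p^{p/2}, its small values in L^{2p} with norm at most (l ‖Δ_j g‖_p)^{1/2}. At the
scale-invariant height l = 2^j M the first bound is 2^{-(d/2-1)j} M, which decays because d ≥ 3,
while the second is exactly critical in regularity s_{2p}. Lowering the slope of log l from 1 to 1 -
1/(2p), with the height unchanged at j = J, gains 2^{-(j-J)/(4p)} in the second bound, enough to pay
for δ. It costs less than 2^{(j-J)/4} in the first, which d ≥ 3 still absorbs. Both parts now decay
geometrically in |j - J|. They sum to O(2^{-(d/2-1)J} M) and O(2^{J/(8p)} M), and 2^J is taken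
comparable to N.

Truncation destroys both the frequency localization and the vanishing divergence. A
frequency-localized Leray projector P_j restores them: it is bounded on L^r uniformly in j, has
divergence-free range, and fixes Δ_j g (`IsLittlewoodPaley.lerayProj_lpProj`). Hence g is the sum of
P_j h_j + P_j b_j over the split blocks h_j + b_j. Each Δ_k meets only five of the P_j, so Besov
norms of the two sums are controlled by the pieces (`IsLittlewoodPaley.exists_besovNorm_le`);
truncation does not increase L^p norms, which gives the critical bounds. -/

open MeasureTheory FourierTransform

/-! ### Convolution inequalities -/

section Convolution

variable {E V : Type*} [NormedAddCommGroup E] [InnerProductSpace ℝ E] [FiniteDimensional ℝ E]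
  [MeasurableSpace E] [BorelSpace E] [NormedAddCommGroup V] [NormedSpace ℂ V]

/-- Young's inequality `‖k * a‖_r ≤ ‖k‖_1 ‖a‖_r`, for functions with values in `[0, ∞]`. -/
theorem lintegral_rpow_lintegral_sub_le {k a : E → ℝ≥0∞} (hk : Measurable k)
    (ha : AEMeasurable a) {r : ℝ} (hr : 1 < r) :
    ∫⁻ x, (∫⁻ y, k (y - x) * a y) ^ r ≤ (∫⁻ x, k x) ^ r * ∫⁻ x, a x ^ r := by
  have hr0 : 0 < r := by linarith
  have hc : r.HolderConjugate (r / (r - 1)) := Real.HolderConjugate.conjExponent hr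
  set q := r / (r - 1) with hq
  have hq0 : 0 < q := hc.symm.pos
  have hsum : 1 / q + 1 / r = 1 := by
    have := hc.inv_add_inv_eq_one
    simp only [one_div]; linarith
  -- Hölder for the splitting k = k^{1/q} · k^{1/r}; integrating in x and applying Tonelli then
  -- gives the claim.
  have hpt : ∀ x, (∫⁻ y, k (y - x) * a y) ^ r ≤
      (∫⁻ x, k x) ^ (r - 1) * ∫⁻ y, k (y - x) * a y ^ r := by
    intro x
    have hkx : Measurable fun y => k (y - x) := hk.comp (measurable_id.sub_const x)
    have h1 : ∫⁻ y, k (y - x) * a y =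
        ∫⁻ y, ((fun y => k (y - x) ^ (1 / q)) * fun y => k (y - x) ^ (1 / r) * a y) y := by
      refine lintegral_congr fun y => ?_
      simp only [Pi.mul_apply]
      rw [← mul_assoc, ← ENNReal.rpow_add_of_nonneg _ _ (by positivity) (by positivity), hsum,
        ENNReal.rpow_one]
    have h2 := ENNReal.lintegral_mul_le_Lp_mul_Lq volume hc.symm
      (f := fun y => k (y - x) ^ (1 / q)) (g := fun y => k (y - x) ^ (1 / r) * a y)
      (hkx.pow_const _).aemeasurable ((hkx.pow_const _).aemeasurable.mul ha)
    have h3 : ∫⁻ y, (k (y - x) ^ (1 / q)) ^ q = ∫⁻ y, k y := by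
      rw [← lintegral_sub_right_eq_self k x]
      refine lintegral_congr fun y => ?_
      rw [← ENNReal.rpow_mul, one_div_mul_cancel hq0.ne', ENNReal.rpow_one]
    have h4 : ∫⁻ y, (k (y - x) ^ (1 / r) * a y) ^ r = ∫⁻ y, k (y - x) * a y ^ r := by
      refine lintegral_congr fun y => ?_
      rw [ENNReal.mul_rpow_of_nonneg _ _ hr0.le, ← ENNReal.rpow_mul, one_div_mul_cancel hr0.ne',
        ENNReal.rpow_one]
    rw [← h1, h3, h4] at h2
    calc (∫⁻ y, k (y - x) * a y) ^ r
        ≤ ((∫⁻ y, k y) ^ (1 / q) * (∫⁻ y, k (y - x) * a y ^ r) ^ (1 / r)) ^ r := by gcongr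
      _ = _ := by
          rw [ENNReal.mul_rpow_of_nonneg _ _ hr0.le, ← ENNReal.rpow_mul, ← ENNReal.rpow_mul,
            one_div_mul_cancel hr0.ne', ENNReal.rpow_one]
          congr 2
          rw [hq]; field_simp
  have hm : AEMeasurable (Function.uncurry fun x y : E => k (y - x) * a y ^ r)
      (volume.prod volume) := by
    refine AEMeasurable.mul (hk.comp (measurable_snd.sub measurable_fst)).aemeasurable ?_
    exact (ha.pow_const r).comp_quasiMeasurePreserving Measure.quasiMeasurePreserving_snd
  calc ∫⁻ x, (∫⁻ y, k (y - x) * a y) ^ r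
      ≤ ∫⁻ x, (∫⁻ x, k x) ^ (r - 1) * ∫⁻ y, k (y - x) * a y ^ r := lintegral_mono hpt
    _ = (∫⁻ x, k x) ^ (r - 1) * ∫⁻ x, ∫⁻ y, k (y - x) * a y ^ r :=
        lintegral_const_mul'' _ hm.lintegral_prod_right'
    _ = (∫⁻ x, k x) ^ (r - 1) * ∫⁻ y, ∫⁻ x, k (y - x) * a y ^ r := by
        rw [lintegral_lintegral_swap hm]
    _ = (∫⁻ x, k x) ^ (r - 1) * ∫⁻ y, (∫⁻ x, k x) * a y ^ r := by
        congr 1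
        refine lintegral_congr fun y => ?_
        have hky : Measurable fun x => k (y - x) := hk.comp (measurable_id.const_sub y)
        rw [lintegral_mul_const _ hky, lintegral_sub_left_eq_self]
    _ = (∫⁻ x, k x) ^ r * ∫⁻ x, a x ^ r := by
        rw [lintegral_const_mul'' _ (ha.pow_const r), ← mul_assoc]
        congr 1
        conv_rhs => rw [show r = (r - 1) + 1 by ring,
          ENNReal.rpow_add_of_nonneg _ _ (by linarith) zero_le_one, ENNReal.rpow_one]

/-- The convolution of `A` with the reflection of `K`. -/
noncomputable def reflConv (K : E → ℂ) (A : E → V) (x : E) : V := ∫ y, K (y - x) • A y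

theorem enorm_reflConv_le (K : E → ℂ) (A : E → V) (x : E) :
    ‖reflConv K A x‖ₑ ≤ ∫⁻ y, ‖K (y - x)‖ₑ * ‖A y‖ₑ := by
  refine (enorm_integral_le_lintegral_enorm _).trans_eq ?_
  simp only [enorm_smul]

theorem aestronglyMeasurable_kernel_smul {K : E → ℂ} (hK : Continuous K) {A : E → V}
    (hA : AEStronglyMeasurable A volume) :
    AEStronglyMeasurable (fun z : E × E => K (z.2 - z.1) • A z.2) (volume.prod volume) :=
  (hK.comp (continuous_snd.sub continuous_fst)).aestronglyMeasurable.smul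
    (hA.comp_quasiMeasurePreserving Measure.quasiMeasurePreserving_snd)

theorem aestronglyMeasurable_reflConv {K : E → ℂ} (hK : Continuous K) {A : E → V}
    (hA : AEStronglyMeasurable A volume) : AEStronglyMeasurable (reflConv K A) volume :=
  (aestronglyMeasurable_kernel_smul hK hA).integral_prod_right'

theorem eLpNorm_reflConv_le {K : E → ℂ} (hK : Continuous K) {A : E → V}
    (hA : AEStronglyMeasurable A volume) {r : ℝ} (hr : 1 < r) :
    eLpNorm (reflConv K A) (ENNReal.ofReal r) volume ≤
      (∫⁻ x, ‖K x‖ₑ) * eLpNorm A (ENNReal.ofReal r) volume := by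
  have hr0 : 0 < r := by linarith
  have h0 : ENNReal.ofReal r ≠ 0 := by simpa using hr0
  rw [eLpNorm_eq_lintegral_rpow_enorm_toReal h0 ENNReal.ofReal_ne_top,
    eLpNorm_eq_lintegral_rpow_enorm_toReal h0 ENNReal.ofReal_ne_top, ENNReal.toReal_ofReal hr0.le]
  calc (∫⁻ x, ‖reflConv K A x‖ₑ ^ r) ^ (1 / r)
      ≤ (∫⁻ x, (∫⁻ y, ‖K (y - x)‖ₑ * ‖A y‖ₑ) ^ r) ^ (1 / r) := by
        gcongr with x
        exact enorm_reflConv_le K A x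
    _ ≤ ((∫⁻ x, ‖K x‖ₑ) ^ r * ∫⁻ x, ‖A x‖ₑ ^ r) ^ (1 / r) := by
        gcongr
        exact lintegral_rpow_lintegral_sub_le (k := fun x => ‖K x‖ₑ) hK.enorm.measurable
          hA.enorm hr
    _ = _ := by
        rw [ENNReal.mul_rpow_of_nonneg _ _ (by positivity), ← ENNReal.rpow_mul,
          mul_one_div_cancel hr0.ne', ENNReal.rpow_one]

/-- Hölder's inequality for a convolution. -/
theorem eLpNorm_top_reflConv_le {K : E → ℂ} (hK : Continuous K) {A : E → V}
    (hA : AEStronglyMeasurable A volume) {r q : ℝ} (hrq : r.HolderConjugate q) :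
    eLpNorm (reflConv K A) ∞ volume ≤
      (∫⁻ x, ‖K x‖ₑ ^ q) ^ (1 / q) * eLpNorm A (ENNReal.ofReal r) volume := by
  have hr0 : 0 < r := hrq.pos
  have h0 : ENNReal.ofReal r ≠ 0 := by simpa using hr0
  rw [eLpNorm_exponent_top,
    eLpNorm_eq_lintegral_rpow_enorm_toReal h0 ENNReal.ofReal_ne_top, ENNReal.toReal_ofReal hr0.le]
  refine eLpNormEssSup_le_of_ae_enorm_bound (Filter.Eventually.of_forall fun x => ?_)
  refine (enorm_reflConv_le K A x).trans ?_
  have hKx : Measurable fun y => ‖K (y - x)‖ₑ :=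
    (hK.comp (continuous_id.sub continuous_const)).enorm.measurable
  refine (ENNReal.lintegral_mul_le_Lp_mul_Lq volume hrq.symm hKx.aemeasurable hA.enorm).trans_eq ?_
  rw [lintegral_sub_right_eq_self (fun y => ‖K y‖ₑ ^ q) x]

/-- Transposition of a convolution, tested against a function of rapid decay. -/
theorem integral_conv_smul_eq_integral_smul_reflConv [CompleteSpace V] (K u : 𝓢(E, ℂ))
    {A : E → V} {r : ℝ} (hr : 1 < r) (hA : MemLp A (ENNReal.ofReal r) volume) :
    ∫ y, (∫ x, K (y - x) * u x) • A y = ∫ x, u x • reflConv K A x := by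
  have hr0 : 0 < r := by linarith
  have hK : Continuous K := K.continuous
  have hm : AEStronglyMeasurable (fun z : E × E => u z.1 • K (z.2 - z.1) • A z.2)
      (volume.prod volume) :=
    (u.continuous.comp continuous_fst).aestronglyMeasurable.smul
      (aestronglyMeasurable_kernel_smul hK hA.1)
  -- Fubini is justified by duality: the convolution of |K| and |A| lies in L^r by Young, and u lies
  -- in the conjugate space.
  have hint : Integrable (fun z : E × E => u z.1 • K (z.2 - z.1) • A z.2)
      (volume.prod volume) := by
    refine ⟨hm, ?_⟩
    rw [hasFiniteIntegral_iff_enorm, lintegral_prod _ hm.enorm]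
    have hc : r.HolderConjugate (r / (r - 1)) := Real.HolderConjugate.conjExponent hr
    have hma : AEMeasurable (fun x => ∫⁻ y, ‖K (y - x)‖ₑ * ‖A y‖ₑ) (volume : Measure E) := by
      have := (aestronglyMeasurable_kernel_smul hK hA.1).enorm.lintegral_prod_right'
      simpa only [enorm_smul] using this
    calc ∫⁻ x, ∫⁻ y, ‖u x • K (y - x) • A y‖ₑ
        = ∫⁻ x, ((fun x => ∫⁻ y, ‖K (y - x)‖ₑ * ‖A y‖ₑ) * fun x => ‖u x‖ₑ) x := by
          refine lintegral_congr fun x => ?_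
          simp only [enorm_smul, Pi.mul_apply]
          rw [lintegral_const_mul'' _ ?_, mul_comm]
          exact ((hK.comp (continuous_id.sub continuous_const)).enorm.aemeasurable).mul hA.1.enorm
      _ ≤ (∫⁻ x, (∫⁻ y, ‖K (y - x)‖ₑ * ‖A y‖ₑ) ^ r) ^ (1 / r) *
            (∫⁻ x, ‖u x‖ₑ ^ (r / (r - 1))) ^ (1 / (r / (r - 1))) :=
          ENNReal.lintegral_mul_le_Lp_mul_Lq volume hc hma u.continuous.enorm.aemeasurable
      _ < ∞ := by
          have h1 := lintegral_rpow_lintegral_sub_le (k := fun x => ‖K x‖ₑ) hK.enorm.measurable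
            hA.1.enorm hr
          have hK1 : ∫⁻ x, ‖K x‖ₑ < ∞ := K.integrable.2
          have hA1 : ∫⁻ x, ‖A x‖ₑ ^ r < ∞ := by
            have := lintegral_rpow_enorm_lt_top_of_eLpNorm_lt_top (by simpa using hr0)
              ENNReal.ofReal_ne_top hA.2
            rwa [ENNReal.toReal_ofReal hr0.le] at this
          have hu1 : ∫⁻ x, ‖u x‖ₑ ^ (r / (r - 1)) < ∞ := by
            have hq0 := hc.symm.pos
            have := lintegral_rpow_enorm_lt_top_of_eLpNorm_lt_top (by simpa using hq0)
              ENNReal.ofReal_ne_top (u.memLp (ENNReal.ofReal (r / (r - 1))) volume).2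
            rwa [ENNReal.toReal_ofReal hq0.le] at this
          refine ENNReal.mul_lt_top (ENNReal.rpow_lt_top_of_nonneg (by positivity) ?_)
            (ENNReal.rpow_lt_top_of_nonneg (one_div_nonneg.2 hc.symm.pos.le) hu1.ne)
          exact (h1.trans_lt (ENNReal.mul_lt_top (ENNReal.rpow_lt_top_of_nonneg hr0.le hK1.ne)
            hA1)).ne
  calc ∫ y, (∫ x, K (y - x) * u x) • A y = ∫ y, ∫ x, u x • K (y - x) • A y := by
        refine integral_congr_ae (Filter.Eventually.of_forall fun y => ?_)
        simp only
        rw [← integral_smul_const]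
        simp only [smul_smul, mul_comm]
    _ = ∫ x, ∫ y, u x • K (y - x) • A y := (integral_integral_swap hint).symm
    _ = _ := by simp only [integral_smul, reflConv]

end Convolution

/-! ### Kernels of Fourier multipliers -/

section Kernel

variable {E : Type*} [NormedAddCommGroup E] [InnerProductSpace ℝ E] [FiniteDimensional ℝ E]
  [MeasurableSpace E] [BorelSpace E]

theorem lintegral_comp_smul_of_pos (f : E → ℝ≥0∞) {c : ℝ} (hc : 0 < c) :
    ∫⁻ x, f (c • x) = ENNReal.ofReal ((c ^ Module.finrank ℝ E)⁻¹) * ∫⁻ x, f x := by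
  have h := (Homeomorph.smulOfNeZero c hc.ne' : E ≃ₜ E).measurableEmbedding.lintegral_map
    (μ := volume) f
  simp only [Homeomorph.smulOfNeZero_apply] at h
  rw [← h]
  have h2 : Measure.map (⇑(Homeomorph.smulOfNeZero c hc.ne' : E ≃ₜ E)) volume =
      ENNReal.ofReal |(c ^ Module.finrank ℝ E)⁻¹| • (volume : Measure E) :=
    Measure.map_addHaar_smul volume hc.ne'
  rw [show (fun x : E => c • x) = ⇑(Homeomorph.smulOfNeZero c hc.ne' : E ≃ₜ E) from rfl, h2,
    lintegral_smul_measure, abs_of_pos (by positivity), smul_eq_mul]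

theorem fourier_comp_smul {V : Type*} [NormedAddCommGroup V] [NormedSpace ℂ V]
    (f : E → V) {c : ℝ} (hc : 0 < c) (x : E) :
    𝓕 (fun ξ => f (c • ξ)) x = (c ^ Module.finrank ℝ E)⁻¹ • 𝓕 f (c⁻¹ • x) := by
  rw [Real.fourier_eq, Real.fourier_eq]
  have := Measure.integral_comp_smul_of_nonneg (volume : Measure E)
    (fun v => Real.fourierChar (-(inner ℝ v (c⁻¹ • x))) • f v) c (hR := hc.le)
  rw [← this]
  congr 1
  ext v
  rw [inner_smul_left, inner_smul_right]
  have hc0 : c ≠ 0 := hc.ne'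
  simp [hc0]

/-- The integral kernel of a Fourier multiplier. -/
theorem fourier_smulLeft_fourierInv_apply (m u : 𝓢(E, ℂ)) (y : E) :
    𝓕 (SchwartzMap.smulLeftCLM ℂ (⇑m) (𝓕⁻ u)) y = ∫ x, 𝓕 m (y - x) * u x := by
  have hint : Integrable (fun z : E × E => ((Real.fourierChar (-(inner ℝ z.1 y)) : Circle) : ℂ) *
      (m z.1 * (((Real.fourierChar (inner ℝ z.2 z.1) : Circle) : ℂ) * u z.2)))
      (volume.prod volume) := by
    refine (m.integrable.mul_prod u.integrable).mono ?_ ?_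
    · refine Continuous.aestronglyMeasurable ?_
      have := m.continuous
      have := u.continuous
      have h3 : Continuous fun z : E × E => ((Real.fourierChar (-(inner ℝ z.1 y)) : Circle) : ℂ) :=
        continuous_subtype_val.comp (Real.continuous_fourierChar.comp (by fun_prop))
      have h4 : Continuous fun z : E × E => ((Real.fourierChar (inner ℝ z.2 z.1) : Circle) : ℂ) :=
        continuous_subtype_val.comp (Real.continuous_fourierChar.comp (by fun_prop))
      fun_prop
    · refine Filter.Eventually.of_forall fun z => ?_
      simp [Circle.norm_coe]
  rw [SchwartzMap.fourier_coe, Real.fourier_eq]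
  calc _ = ∫ ξ, ∫ x, ((Real.fourierChar (-(inner ℝ ξ y)) : Circle) : ℂ) *
      (m ξ * (((Real.fourierChar (inner ℝ x ξ) : Circle) : ℂ) * u x)) := by
        refine integral_congr_ae (Filter.Eventually.of_forall fun ξ => ?_)
        simp only
        rw [SchwartzMap.smulLeftCLM_apply_apply m.hasTemperateGrowth, SchwartzMap.fourierInv_coe,
          Real.fourierInv_eq, integral_const_mul, integral_const_mul]
        simp only [Circle.smul_def, smul_eq_mul]
    _ = ∫ x, ∫ ξ, ((Real.fourierChar (-(inner ℝ ξ y)) : Circle) : ℂ) *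
      (m ξ * (((Real.fourierChar (inner ℝ x ξ) : Circle) : ℂ) * u x)) :=
        integral_integral_swap hint
    _ = _ := by
        refine integral_congr_ae (Filter.Eventually.of_forall fun x => ?_)
        simp only
        rw [SchwartzMap.fourier_coe, Real.fourier_eq, ← integral_mul_const]
        refine integral_congr_ae (Filter.Eventually.of_forall fun ξ => ?_)
        simp only [Circle.smul_def, smul_eq_mul]
        rw [inner_sub_right, real_inner_comm ξ x, neg_sub, sub_eq_add_neg, AddChar.map_add_eq_mul,
          Circle.coe_mul]
        ring

end Kernel

/-! ### The L^p norm of a distribution -/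

section DistLpNorm

variable {d : ℕ}

theorem distLpNorm_le_eLpNorm {p : ℝ≥0∞} {f : VectorDistribution d}
    {F : EuclideanSpace ℝ (Fin d) → EuclideanSpace ℂ (Fin d)} (hF : MemLp F p volume)
    (h : ∀ u : 𝓢(EuclideanSpace ℝ (Fin d), ℂ), f u = ∫ x, u x • F x) :
    distLpNorm p f ≤ eLpNorm F p volume :=
  iInf_le_of_le F (iInf_le_of_le hF (iInf_le_of_le h le_rfl))

/-- A distribution is represented by at most one locally integrable function. -/
theorem ae_eq_of_forall_integral_smul_eq {p q : ℝ≥0∞} (hp : 1 ≤ p) (hq : 1 ≤ q)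
    {F G : EuclideanSpace ℝ (Fin d) → EuclideanSpace ℂ (Fin d)} (hF : MemLp F p volume)
    (hG : MemLp G q volume)
    (h : ∀ u : 𝓢(EuclideanSpace ℝ (Fin d), ℂ), ∫ x, u x • F x = ∫ x, u x • G x) :
    F =ᵐ[volume] G := by
  have hFl := hF.locallyIntegrable hp
  have hGl := hG.locallyIntegrable hq
  have := ae_eq_zero_of_integral_contDiff_smul_eq_zero (hFl.sub hGl) (fun g hg hgc => by
    have hg₁ : HasCompactSupport (Complex.ofRealCLM ∘ g) := hgc.comp_left rfl
    have hg₂ : ContDiff ℝ (⊤ : ℕ∞) (Complex.ofRealCLM ∘ g) := by fun_prop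
    have h1 := h (hg₁.toSchwartzMap hg₂)
    simp only [HasCompactSupport.toSchwartzMap_toFun, Function.comp_apply,
      Complex.ofRealCLM_apply, Complex.coe_smul] at h1
    simp only [Pi.sub_apply, smul_sub]
    rw [integral_sub (hFl.integrable_smul_left_of_hasCompactSupport hg.continuous hgc)
      (hGl.integrable_smul_left_of_hasCompactSupport hg.continuous hgc), h1, sub_self])
  filter_upwards [this] with x hx
  exact sub_eq_zero.1 hx

/-- Representatives agree almost everywhere, so the infimum runs over a single value. -/
theorem exists_eLpNorm_eq_distLpNorm {p : ℝ≥0∞} (hp : 1 ≤ p) {f : VectorDistribution d}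
    (hf : distLpNorm p f < ∞) :
    ∃ F : EuclideanSpace ℝ (Fin d) → EuclideanSpace ℂ (Fin d), MemLp F p volume ∧
      (∀ u : 𝓢(EuclideanSpace ℝ (Fin d), ℂ), f u = ∫ x, u x • F x) ∧
      eLpNorm F p volume = distLpNorm p f := by
  simp only [distLpNorm, iInf_lt_iff] at hf
  obtain ⟨F, hF, h, -⟩ := hf
  refine ⟨F, hF, h, le_antisymm ?_ (distLpNorm_le_eLpNorm hF h)⟩
  refine le_iInf fun G => le_iInf fun hG => le_iInf fun hG' => ?_
  rw [eLpNorm_congr_ae (ae_eq_of_forall_integral_smul_eq hp hp hF hG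
    fun u => (h u).symm.trans (hG' u))]

theorem integrable_schwartz_smul {p : ℝ≥0∞} (hp : 1 ≤ p)
    {F : EuclideanSpace ℝ (Fin d) → EuclideanSpace ℂ (Fin d)} (hF : MemLp F p volume)
    (u : 𝓢(EuclideanSpace ℝ (Fin d), ℂ)) : Integrable (fun x => u x • F x) volume := by
  have := ENNReal.HolderConjugate.inv_one_sub_inv' hp
  have : ENNReal.HolderTriple (1 - p⁻¹)⁻¹ p 1 := ENNReal.HolderTriple.symm
  exact memLp_one_iff_integrable.1 (hF.smul (u.memLp (1 - p⁻¹)⁻¹ volume))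

theorem distLpNorm_zero (p : ℝ≥0∞) : distLpNorm p (0 : VectorDistribution d) = 0 := by
  refine le_antisymm ?_ bot_le
  refine (distLpNorm_le_eLpNorm (F := 0) MemLp.zero fun u => ?_).trans_eq eLpNorm_zero
  simp

theorem distLpNorm_add_le {p : ℝ≥0∞} (hp : 1 ≤ p) (f g : VectorDistribution d) :
    distLpNorm p (f + g) ≤ distLpNorm p f + distLpNorm p g := by
  by_cases hf : distLpNorm p f < ∞
  swap
  · simp [not_lt_top_iff.1 hf]
  by_cases hg : distLpNorm p g < ∞
  swap
  · simp [not_lt_top_iff.1 hg]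
  obtain ⟨F, hF, hF', hFn⟩ := exists_eLpNorm_eq_distLpNorm hp hf
  obtain ⟨G, hG, hG', hGn⟩ := exists_eLpNorm_eq_distLpNorm hp hg
  rw [← hFn, ← hGn]
  refine (distLpNorm_le_eLpNorm (hF.add hG) fun u => ?_).trans (eLpNorm_add_le hF.1 hG.1 hp)
  simp only [Pi.add_apply, smul_add]
  rw [integral_add (integrable_schwartz_smul hp hF u) (integrable_schwartz_smul hp hG u), ← hF',
    ← hG']
  rfl

theorem distLpNorm_sum_le {ι : Type*} {p : ℝ≥0∞} (hp : 1 ≤ p) (s : Finset ι)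
    (f : ι → VectorDistribution d) :
    distLpNorm p (∑ i ∈ s, f i) ≤ ∑ i ∈ s, distLpNorm p (f i) := by
  classical
  induction s using Finset.induction_on with
  | empty => simp [distLpNorm_zero]
  | insert a s ha ih =>
    rw [Finset.sum_insert ha, Finset.sum_insert ha]
    exact (distLpNorm_add_le hp _ _).trans (by gcongr)

/-- Postcomposition of a distribution with a linear map on its values. -/
noncomputable def mapValues (L : EuclideanSpace ℂ (Fin d) →L[ℂ] EuclideanSpace ℂ (Fin d)) :
    VectorDistribution d →L[ℂ] VectorDistribution d :=
  PointwiseConvergenceCLM.postcomp _ L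

theorem mapValues_apply (L : EuclideanSpace ℂ (Fin d) →L[ℂ] EuclideanSpace ℂ (Fin d))
    (f : VectorDistribution d) (u : 𝓢(EuclideanSpace ℝ (Fin d), ℂ)) :
    mapValues L f u = L (f u) := rfl

theorem distLpNorm_mapValues_le {p : ℝ≥0∞} (hp : 1 ≤ p)
    {L : EuclideanSpace ℂ (Fin d) →L[ℂ] EuclideanSpace ℂ (Fin d)} (hL : ∀ v, ‖L v‖ ≤ ‖v‖)
    (f : VectorDistribution d) : distLpNorm p (mapValues L f) ≤ distLpNorm p f := by
  by_cases hf : distLpNorm p f < ∞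
  swap
  · simp [not_lt_top_iff.1 hf]
  obtain ⟨F, hF, hF', hFn⟩ := exists_eLpNorm_eq_distLpNorm hp hf
  rw [← hFn]
  refine (distLpNorm_le_eLpNorm (F := fun x => L (F x)) (L.comp_memLp' hF) fun u => ?_).trans
    (eLpNorm_mono fun x => hL _)
  rw [mapValues_apply, hF', ← L.integral_comp_comm (integrable_schwartz_smul hp hF u)]
  simp

/-- An absolutely convergent series in `L^p` converges in the sense of distributions. -/
theorem exists_hasSum_of_tsum_distLpNorm_lt_top {ι : Type*} {p : ℝ≥0∞} (hp : 1 ≤ p)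
    {f : ι → VectorDistribution d} (hf : ∑' i, distLpNorm p (f i) < ∞) :
    ∃ g, HasSum f g ∧ distLpNorm p g ≤ ∑' i, distLpNorm p (f i) := by
  have : Fact (1 ≤ p) := ⟨hp⟩
  have hfi : ∀ i, distLpNorm p (f i) < ∞ := fun i => (ENNReal.le_tsum i).trans_lt hf
  choose F hF hF' hFn using fun i => exists_eLpNorm_eq_distLpNorm hp (hfi i)
  have hnorm : ∀ i, ‖(hF i).toLp (F i)‖ₑ = distLpNorm p (f i) := fun i => by
    rw [Lp.enorm_toLp, hFn]
  -- The series is summed in the complete space L^p and transported by the continuous embedding into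
  -- distributions.
  have hs : Summable fun i => (hF i).toLp (F i) := by
    refine Summable.of_enorm ?_
    simpa only [hnorm] using hf.ne
  have hT := hs.hasSum.mapL (Lp.toTemperedDistributionCLM (EuclideanSpace ℂ (Fin d))
    (volume : Measure (EuclideanSpace ℝ (Fin d))) p)
  have hfe : ∀ i, Lp.toTemperedDistributionCLM (EuclideanSpace ℂ (Fin d))
      (volume : Measure (EuclideanSpace ℝ (Fin d))) p ((hF i).toLp (F i)) = f i := by
    intro i
    ext1 u
    rw [Lp.toTemperedDistributionCLM_apply, Lp.toTemperedDistribution_apply, hF']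
    refine integral_congr_ae ?_
    filter_upwards [(hF i).coeFn_toLp] with x hx
    rw [hx]
  simp only [hfe] at hT
  refine ⟨_, hT, ?_⟩
  refine (distLpNorm_le_eLpNorm (Lp.memLp (∑' i, (hF i).toLp (F i))) fun u => ?_).trans ?_
  · rw [Lp.toTemperedDistributionCLM_apply, Lp.toTemperedDistribution_apply]
  · rw [← Lp.enorm_def]
    refine enorm_tsum_le_tsum_enorm.trans_eq ?_
    simp only [hnorm]

end DistLpNorm

/-! ### Multipliers on L^r and Bernstein's inequality -/

section MultiplierBounds

variable {d : ℕ}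

/-- On test functions the multiplier is convolution with `𝓕 m`; Fubini moves it onto F, where the
kernel appears reflected. -/
theorem fourierMultiplierCLM_eq_integral_reflConv (m : 𝓢(EuclideanSpace ℝ (Fin d), ℂ))
    {f : VectorDistribution d} {F : EuclideanSpace ℝ (Fin d) → EuclideanSpace ℂ (Fin d)} {r : ℝ}
    (hr : 1 < r) (hF : MemLp F (ENNReal.ofReal r) volume)
    (h : ∀ u : 𝓢(EuclideanSpace ℝ (Fin d), ℂ), f u = ∫ x, u x • F x)
    (u : 𝓢(EuclideanSpace ℝ (Fin d), ℂ)) :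
    TemperedDistribution.fourierMultiplierCLM (EuclideanSpace ℂ (Fin d)) (⇑m) f u =
      ∫ x, u x • reflConv (𝓕 m : 𝓢(EuclideanSpace ℝ (Fin d), ℂ)) F x := by
  rw [TemperedDistribution.fourierMultiplierCLM_apply_apply, h,
    ← integral_conv_smul_eq_integral_smul_reflConv _ u hr hF]
  simp only [fourier_smulLeft_fourierInv_apply]

theorem one_le_ofReal_of_one_lt {r : ℝ} (hr : 1 < r) : 1 ≤ ENNReal.ofReal r := by
  simpa using ENNReal.ofReal_le_ofReal hr.le

theorem distLpNorm_fourierMultiplierCLM_le (m : 𝓢(EuclideanSpace ℝ (Fin d), ℂ)) {r : ℝ}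
    (hr : 1 < r) {f : VectorDistribution d} (hf : distLpNorm (ENNReal.ofReal r) f < ∞) :
    distLpNorm (ENNReal.ofReal r)
        (TemperedDistribution.fourierMultiplierCLM (EuclideanSpace ℂ (Fin d)) (⇑m) f) ≤
      (∫⁻ x, ‖𝓕 (⇑m) x‖ₑ) * distLpNorm (ENNReal.ofReal r) f := by
  have hr1 := one_le_ofReal_of_one_lt hr
  have hK1 : ∫⁻ x, ‖𝓕 (⇑m) x‖ₑ < ∞ := (𝓕 m).integrable.2
  obtain ⟨F, hF, hF', hFn⟩ := exists_eLpNorm_eq_distLpNorm hr1 hf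
  have hle := eLpNorm_reflConv_le (𝓕 m).continuous hF.1 hr
  rw [← hFn]
  refine (distLpNorm_le_eLpNorm ⟨aestronglyMeasurable_reflConv (𝓕 m).continuous hF.1, ?_⟩
    (fourierMultiplierCLM_eq_integral_reflConv m hr hF hF')).trans hle
  exact hle.trans_lt (ENNReal.mul_lt_top hK1 hF.2)

theorem distLpNorm_top_fourierMultiplierCLM_le (m : 𝓢(EuclideanSpace ℝ (Fin d), ℂ)) {r q : ℝ}
    (hrq : r.HolderConjugate q) {f : VectorDistribution d}
    (hf : distLpNorm (ENNReal.ofReal r) f < ∞) :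
    distLpNorm ∞ (TemperedDistribution.fourierMultiplierCLM (EuclideanSpace ℂ (Fin d)) (⇑m) f) ≤
      (∫⁻ x, ‖𝓕 (⇑m) x‖ₑ ^ q) ^ (1 / q) * distLpNorm (ENNReal.ofReal r) f := by
  have hq0 := hrq.symm.pos
  have hK1 : ∫⁻ x, ‖𝓕 (⇑m) x‖ₑ ^ q < ∞ := by
    have := lintegral_rpow_enorm_lt_top_of_eLpNorm_lt_top (by simpa using hq0)
      ENNReal.ofReal_ne_top ((𝓕 m).memLp (ENNReal.ofReal q) volume).2
    rwa [ENNReal.toReal_ofReal hq0.le] at this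
  obtain ⟨F, hF, hF', hFn⟩ :=
    exists_eLpNorm_eq_distLpNorm (one_le_ofReal_of_one_lt hrq.lt) hf
  have hle := eLpNorm_top_reflConv_le (𝓕 m).continuous hF.1 hrq
  rw [← hFn]
  refine (distLpNorm_le_eLpNorm ⟨aestronglyMeasurable_reflConv (𝓕 m).continuous hF.1, ?_⟩
    (fourierMultiplierCLM_eq_integral_reflConv m hrq.lt hF hF')).trans hle
  exact hle.trans_lt (ENNReal.mul_lt_top (ENNReal.rpow_lt_top_of_nonneg (by positivity) hK1.ne)
    hF.2)

/-- Change of variables in 𝓕(m(c·)) = c^{-d} 𝓕m(·/c). The case q = 1 gives bounds independent of the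
dilation; q conjugate to r gives the Bernstein power c^{-d/r}. -/
theorem lintegral_enorm_fourier_comp_smul_rpow (m : EuclideanSpace ℝ (Fin d) → ℂ) {c : ℝ}
    (hc : 0 < c) {q : ℝ} (hq : 0 < q) :
    ∫⁻ x, ‖𝓕 (fun ξ => m (c • ξ)) x‖ₑ ^ q =
      ENNReal.ofReal (c ^ ((d : ℝ) * (1 - q))) * ∫⁻ x, ‖𝓕 m x‖ₑ ^ q := by
  simp only [fourier_comp_smul m hc, enorm_smul]
  have h1 : ∀ x, (‖(c ^ Module.finrank ℝ (EuclideanSpace ℝ (Fin d)))⁻¹‖ₑ * ‖𝓕 m (c⁻¹ • x)‖ₑ) ^ q =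
      ENNReal.ofReal (c ^ (-(d : ℝ) * q)) * ‖𝓕 m (c⁻¹ • x)‖ₑ ^ q := by
    intro x
    rw [ENNReal.mul_rpow_of_nonneg _ _ hq.le, Real.enorm_of_nonneg (by positivity),
      ENNReal.ofReal_rpow_of_nonneg (by positivity) hq.le, finrank_euclideanSpace_fin,
      Real.rpow_mul hc.le, Real.rpow_neg hc.le, Real.rpow_natCast]
  simp only [h1]
  rw [lintegral_const_mul' _ _ ENNReal.ofReal_ne_top,
    lintegral_comp_smul_of_pos (fun x => ‖𝓕 m x‖ₑ ^ q) (inv_pos.2 hc), ← mul_assoc,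
    ← ENNReal.ofReal_mul (by positivity), finrank_euclideanSpace_fin, inv_pow, inv_inv,
    ← Real.rpow_natCast, ← Real.rpow_add hc]
  congr 3
  ring

/-- A smooth symbol with compact support acts on `L^r` uniformly in the dilation. -/
theorem exists_distLpNorm_dilated_multiplier_le {m : EuclideanSpace ℝ (Fin d) → ℂ}
    (hm : ContDiff ℝ (⊤ : ℕ∞) m) (hmc : HasCompactSupport m) :
    ∃ C : ℝ≥0∞, C < ∞ ∧ ∀ (c : ℝ) (_ : 0 < c) (r : ℝ) (_ : 1 < r) (f : VectorDistribution d),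
      distLpNorm (ENNReal.ofReal r) (TemperedDistribution.fourierMultiplierCLM
        (EuclideanSpace ℂ (Fin d)) (fun ξ => m (c • ξ)) f) ≤
      C * distLpNorm (ENNReal.ofReal r) f := by
  -- The added 1 makes the constant nonzero, so that the bound is trivially true when the norm of f
  -- is infinite.
  refine ⟨(∫⁻ x, ‖𝓕 m x‖ₑ) + 1, ENNReal.add_lt_top.2
    ⟨(𝓕 (hmc.toSchwartzMap hm)).integrable.2, ENNReal.one_lt_top⟩, fun c hc r hr f => ?_⟩
  by_cases hf : distLpNorm (ENNReal.ofReal r) f < ∞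
  swap
  · rw [not_lt_top_iff.1 hf, ENNReal.mul_top (by simp)]
    exact le_top
  have hmc' : HasCompactSupport fun ξ => m (c • ξ) := hmc.comp_smul hc.ne'
  have hm' : ContDiff ℝ (⊤ : ℕ∞) fun ξ => m (c • ξ) := hm.comp (contDiff_const_smul c)
  have h := distLpNorm_fourierMultiplierCLM_le (hmc'.toSchwartzMap hm') hr hf
  have h2 := lintegral_enorm_fourier_comp_smul_rpow m hc one_pos
  simp only [ENNReal.rpow_one, sub_self, mul_zero, Real.rpow_zero, ENNReal.ofReal_one,
    one_mul] at h2
  rw [← h2]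
  exact h.trans (by gcongr; exact le_self_add)

/-- Bernstein's inequality from `L^r` to `L^∞`. -/
theorem exists_distLpNorm_top_dilated_multiplier_le {m : EuclideanSpace ℝ (Fin d) → ℂ}
    (hm : ContDiff ℝ (⊤ : ℕ∞) m) (hmc : HasCompactSupport m) {r : ℝ} (hr : 1 < r) :
    ∃ C : ℝ≥0∞, C < ∞ ∧ ∀ (c : ℝ) (_ : 0 < c) (f : VectorDistribution d)
      (_ : distLpNorm (ENNReal.ofReal r) f < ∞),
      distLpNorm ∞ (TemperedDistribution.fourierMultiplierCLM
        (EuclideanSpace ℂ (Fin d)) (fun ξ => m (c • ξ)) f) ≤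
      C * ENNReal.ofReal (c ^ (-((d : ℝ) / r))) * distLpNorm (ENNReal.ofReal r) f := by
  have hrq : r.HolderConjugate (r / (r - 1)) := Real.HolderConjugate.conjExponent hr
  set q := r / (r - 1) with hq
  have hq0 := hrq.symm.pos
  refine ⟨(∫⁻ x, ‖𝓕 m x‖ₑ ^ q) ^ (1 / q), ?_, fun c hc f hf => ?_⟩
  · have := lintegral_rpow_enorm_lt_top_of_eLpNorm_lt_top (by simpa using hq0)
      ENNReal.ofReal_ne_top ((𝓕 (hmc.toSchwartzMap hm)).memLp (ENNReal.ofReal q) volume).2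
    rw [ENNReal.toReal_ofReal hq0.le] at this
    exact ENNReal.rpow_lt_top_of_nonneg (by positivity) this.ne
  have hmc' : HasCompactSupport fun ξ => m (c • ξ) := hmc.comp_smul hc.ne'
  have hm' : ContDiff ℝ (⊤ : ℕ∞) fun ξ => m (c • ξ) := hm.comp (contDiff_const_smul c)
  refine (distLpNorm_top_fourierMultiplierCLM_le (hmc'.toSchwartzMap hm') hrq hf).trans_eq ?_
  congr 1
  have h2 := lintegral_enorm_fourier_comp_smul_rpow m hc hq0
  have h3 : (∫⁻ x, ‖𝓕 (⇑(hmc'.toSchwartzMap hm')) x‖ₑ ^ q) =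
    ∫⁻ x, ‖𝓕 (fun ξ => m (c • ξ)) x‖ₑ ^ q := rfl
  rw [h3, h2, ENNReal.mul_rpow_of_nonneg _ _ (by positivity),
    ENNReal.ofReal_rpow_of_nonneg (by positivity) (by positivity), mul_comm, ← Real.rpow_mul hc.le]
  congr 3
  have h4 : r - 1 ≠ 0 := by linarith
  have h5 : r ≠ 0 := by linarith
  rw [hq]
  field_simp
  ring

end MultiplierBounds

/-! ### Annular symbols and their dyadic dilates -/

section Symbols

variable {d : ℕ}

/-- A smooth symbol supported in the annulus `3/8 ≤ |ξ| ≤ 16/3`. -/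
structure IsAnnularSymbol (m : EuclideanSpace ℝ (Fin d) → ℂ) : Prop where
  smooth : ContDiff ℝ (⊤ : ℕ∞) m
  support : ∀ ξ, m ξ ≠ 0 → 3 / 8 ≤ ‖ξ‖ ∧ ‖ξ‖ ≤ 16 / 3

namespace IsAnnularSymbol

variable {m : EuclideanSpace ℝ (Fin d) → ℂ}

theorem hasCompactSupport (hm : IsAnnularSymbol m) : HasCompactSupport m := by
  refine HasCompactSupport.intro (isCompact_closedBall (0 : EuclideanSpace ℝ (Fin d)) (16 / 3))
    fun ξ hξ => ?_
  by_contra h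
  exact hξ (by simpa using (hm.support ξ h).2)

/-- The symbol vanishes near the origin, so a singularity of h there is invisible. This admits
factors such as ξ_a ξ_b / |ξ|². -/
theorem mul_of_contDiffAt (hm : IsAnnularSymbol m) {h : EuclideanSpace ℝ (Fin d) → ℂ}
    (hh : ∀ ξ, ξ ≠ 0 → ContDiffAt ℝ (⊤ : ℕ∞) h ξ) : IsAnnularSymbol fun ξ => h ξ * m ξ := by
  refine ⟨contDiff_iff_contDiffAt.2 fun ξ => ?_, fun ξ hξ => hm.support ξ (right_ne_zero_of_mul hξ)⟩
  by_cases h0 : ξ = 0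
  · have : (fun ξ => h ξ * m ξ) =ᶠ[nhds ξ] fun _ => 0 := by
      have hb : Metric.ball (0 : EuclideanSpace ℝ (Fin d)) (3 / 8) ∈ nhds ξ := by
        rw [h0]; exact Metric.ball_mem_nhds _ (by norm_num)
      filter_upwards [hb] with η hη
      have : m η = 0 := by
        by_contra h1
        have := (hm.support η h1).1
        rw [mem_ball_zero_iff] at hη
        linarith
      rw [this, mul_zero]
    exact contDiffAt_const.congr_of_eventuallyEq this
  · exact (hh ξ h0).mul hm.smooth.contDiffAt

end IsAnnularSymbol

/-- The dilated symbol of `m(2⁻ʲ D)`. -/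
noncomputable def dyadicSymbol (m : EuclideanSpace ℝ (Fin d) → ℂ) (j : ℤ)
    (ξ : EuclideanSpace ℝ (Fin d)) : ℂ :=
  m ((2 : ℝ) ^ (-j) • (2 * Real.pi) • ξ)

theorem dyadicSymbol_eq (m : EuclideanSpace ℝ (Fin d) → ℂ) (j : ℤ) :
    dyadicSymbol m j = fun ξ => m (((2 : ℝ) ^ (-j) * (2 * Real.pi)) • ξ) := by
  ext ξ
  rw [dyadicSymbol, smul_smul]

theorem dyadicScale_pos (j : ℤ) : 0 < (2 : ℝ) ^ (-j) * (2 * Real.pi) := by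
  have := Real.pi_pos
  positivity

theorem IsAnnularSymbol.contDiff_dyadicSymbol {m : EuclideanSpace ℝ (Fin d) → ℂ}
    (hm : IsAnnularSymbol m) (j : ℤ) : ContDiff ℝ (⊤ : ℕ∞) (dyadicSymbol m j) := by
  rw [dyadicSymbol_eq]
  exact hm.smooth.comp (contDiff_const_smul _)

theorem IsAnnularSymbol.hasCompactSupport_dyadicSymbol {m : EuclideanSpace ℝ (Fin d) → ℂ}
    (hm : IsAnnularSymbol m) (j : ℤ) : HasCompactSupport (dyadicSymbol m j) := by
  rw [dyadicSymbol_eq]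
  exact hm.hasCompactSupport.comp_smul (dyadicScale_pos j).ne'

theorem IsAnnularSymbol.hasTemperateGrowth_dyadicSymbol {m : EuclideanSpace ℝ (Fin d) → ℂ}
    (hm : IsAnnularSymbol m) (j : ℤ) : (dyadicSymbol m j).HasTemperateGrowth :=
  (hm.hasCompactSupport_dyadicSymbol j).hasTemperateGrowth (hm.contDiff_dyadicSymbol j)

/-- The Fourier multiplier `m(2⁻ʲ D)`. -/
noncomputable def dyadicMul (m : EuclideanSpace ℝ (Fin d) → ℂ) (j : ℤ) :
    VectorDistribution d →L[ℂ] VectorDistribution d :=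
  TemperedDistribution.fourierMultiplierCLM (EuclideanSpace ℂ (Fin d)) (dyadicSymbol m j)

theorem dyadicMul_apply (m : EuclideanSpace ℝ (Fin d) → ℂ) (j : ℤ) (f : VectorDistribution d)
    (u : 𝓢(EuclideanSpace ℝ (Fin d), ℂ)) :
    dyadicMul m j f u = f (𝓕 (SchwartzMap.smulLeftCLM ℂ (dyadicSymbol m j) (𝓕⁻ u))) := rfl

theorem lpProj_eq_dyadicMul (φ : EuclideanSpace ℝ (Fin d) → ℝ) (j : ℤ)
    (f : VectorDistribution d) : lpProj φ j f = dyadicMul (fun ξ => (φ ξ : ℂ)) j f := rfl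

theorem dyadicMul_mapValues (m : EuclideanSpace ℝ (Fin d) → ℂ) (j : ℤ)
    (L : EuclideanSpace ℂ (Fin d) →L[ℂ] EuclideanSpace ℂ (Fin d)) (f : VectorDistribution d) :
    dyadicMul m j (mapValues L f) = mapValues L (dyadicMul m j f) := rfl

theorem dyadicMul_dyadicMul {m n : EuclideanSpace ℝ (Fin d) → ℂ} (hm : IsAnnularSymbol m)
    (hn : IsAnnularSymbol n) (j k : ℤ) (f : VectorDistribution d) :
    dyadicMul m j (dyadicMul n k f) = TemperedDistribution.fourierMultiplierCLM
      (EuclideanSpace ℂ (Fin d)) (dyadicSymbol n k * dyadicSymbol m j) f :=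
  TemperedDistribution.fourierMultiplierCLM_fourierMultiplierCLM_apply
    (hn.hasTemperateGrowth_dyadicSymbol k) (hm.hasTemperateGrowth_dyadicSymbol j) f

theorem exists_distLpNorm_dyadicMul_le {m : EuclideanSpace ℝ (Fin d) → ℂ}
    (hm : IsAnnularSymbol m) :
    ∃ C : ℝ≥0∞, C < ∞ ∧ ∀ (j : ℤ) (r : ℝ) (_ : 1 < r) (f : VectorDistribution d),
      distLpNorm (ENNReal.ofReal r) (dyadicMul m j f) ≤ C * distLpNorm (ENNReal.ofReal r) f := by
  obtain ⟨C, hC, h⟩ := exists_distLpNorm_dilated_multiplier_le hm.smooth hm.hasCompactSupport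
  refine ⟨C, hC, fun j r hr f => ?_⟩
  rw [dyadicMul, dyadicSymbol_eq]
  exact h _ (dyadicScale_pos j) r hr f

theorem exists_distLpNorm_top_dyadicMul_le {m : EuclideanSpace ℝ (Fin d) → ℂ}
    (hm : IsAnnularSymbol m) {r : ℝ} (hr : 1 < r) :
    ∃ C : ℝ≥0∞, C < ∞ ∧ ∀ (j : ℤ) (f : VectorDistribution d)
      (_ : distLpNorm (ENNReal.ofReal r) f < ∞),
      distLpNorm ∞ (dyadicMul m j f) ≤
        C * ENNReal.ofReal ((2 : ℝ) ^ ((j : ℝ) * (d / r))) * distLpNorm (ENNReal.ofReal r) f := by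
  obtain ⟨C, hC, h⟩ :=
    exists_distLpNorm_top_dilated_multiplier_le hm.smooth hm.hasCompactSupport hr
  have hpi := Real.pi_pos
  refine ⟨C * ENNReal.ofReal ((2 * Real.pi) ^ (-((d : ℝ) / r))),
    ENNReal.mul_lt_top hC ENNReal.ofReal_lt_top, fun j f hf => ?_⟩
  rw [dyadicMul, dyadicSymbol_eq]
  refine (h _ (dyadicScale_pos j) f hf).trans_eq ?_
  congr 1
  rw [mul_assoc, ← ENNReal.ofReal_mul (by positivity),
    Real.mul_rpow (by positivity) (by positivity), ← Real.rpow_intCast,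
    ← Real.rpow_mul zero_le_two]
  congr 2
  rw [mul_comm]
  congr 2
  push_cast
  ring

end Symbols

/-! ### Overlap of Littlewood–Paley blocks -/

section LittlewoodPaley

variable {d : ℕ} {φ : EuclideanSpace ℝ (Fin d) → ℝ}

namespace IsLittlewoodPaley

theorem isAnnularSymbol (hφ : IsLittlewoodPaley φ) : IsAnnularSymbol fun ξ => (φ ξ : ℂ) := by
  refine ⟨Complex.ofRealCLM.contDiff.comp hφ.smooth, fun ξ hξ => ?_⟩
  have := hφ.support ξ (by exact_mod_cast hξ)
  constructor <;> linarith [this.1, this.2]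

/-- Three dyadic steps separate the annuli: 8 · 3/8 > 8/3 and (16/3)/8 < 3/4. Hence five dilates of
φ suffice on the larger annulus. -/
theorem apply_zpow_smul_eq_zero (hφ : IsLittlewoodPaley φ) {ξ : EuclideanSpace ℝ (Fin d)}
    (h1 : 3 / 8 ≤ ‖ξ‖) (h2 : ‖ξ‖ ≤ 16 / 3) {i : ℤ} (hi : i ∉ Finset.Icc (-2 : ℤ) 2) :
    φ ((2 : ℝ) ^ (-i) • ξ) = 0 := by
  by_contra h
  have h3 := hφ.support _ h
  rw [norm_smul, norm_zpow, Real.norm_ofNat] at h3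
  rw [Finset.mem_Icc, not_and_or, not_le, not_le] at hi
  rcases hi with hi | hi
  · have : (2 : ℝ) ^ (3 : ℤ) ≤ (2 : ℝ) ^ (-i) := zpow_le_zpow_right₀ one_le_two (by omega)
    have h8 : (2 : ℝ) ^ (3 : ℤ) = 8 := by norm_num
    nlinarith [h3.2]
  · have : (2 : ℝ) ^ (-i) ≤ (2 : ℝ) ^ (-3 : ℤ) := zpow_le_zpow_right₀ one_le_two (by omega)
    have h8 : (2 : ℝ) ^ (-3 : ℤ) = 1 / 8 := by norm_num
    have := mul_le_mul this h2 (norm_nonneg ξ) (by positivity)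
    linarith [h3.1]

theorem sum_apply_zpow_smul (hφ : IsLittlewoodPaley φ) {ξ : EuclideanSpace ℝ (Fin d)}
    (h1 : 3 / 8 ≤ ‖ξ‖) (h2 : ‖ξ‖ ≤ 16 / 3) :
    ∑ i ∈ Finset.Icc (-2 : ℤ) 2, φ ((2 : ℝ) ^ (-i) • ξ) = 1 := by
  have h0 : ξ ≠ 0 := by
    rintro rfl
    rw [norm_zero] at h1
    linarith
  exact (hasSum_sum_of_ne_finset_zero fun i hi => hφ.apply_zpow_smul_eq_zero h1 h2 hi).unique
    (hφ.partition ξ h0)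

theorem lpProj_dyadicMul_eq_zero (hφ : IsLittlewoodPaley φ)
    {m : EuclideanSpace ℝ (Fin d) → ℂ} (hm : IsAnnularSymbol m) {i : ℤ}
    (hi : i ∉ Finset.Icc (-2 : ℤ) 2) (j : ℤ) (f : VectorDistribution d) :
    lpProj φ (j + i) (dyadicMul m j f) = 0 := by
  rw [lpProj_eq_dyadicMul, dyadicMul_dyadicMul hφ.isAnnularSymbol hm]
  have : dyadicSymbol m j * dyadicSymbol (fun ξ => (φ ξ : ℂ)) (j + i) = fun _ => 0 := by
    ext ξ
    simp only [Pi.mul_apply, dyadicSymbol, mul_eq_zero]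
    by_contra! h
    refine h.2 ?_
    obtain ⟨h1, h2⟩ := hm.support _ h.1
    have := hφ.apply_zpow_smul_eq_zero h1 h2 hi
    rw [smul_smul, ← zpow_add₀ two_ne_zero] at this
    rw [show -(j + i) = -i + -j by ring, this, Complex.ofReal_zero]
  rw [this, TemperedDistribution.fourierMultiplierCLM_const, zero_smul]
  rfl

theorem sum_lpProj_dyadicMul (hφ : IsLittlewoodPaley φ)
    {m : EuclideanSpace ℝ (Fin d) → ℂ} (hm : IsAnnularSymbol m) (j : ℤ)
    (f : VectorDistribution d) :
    ∑ i ∈ Finset.Icc (-2 : ℤ) 2, lpProj φ (j + i) (dyadicMul m j f) = dyadicMul m j f := by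
  simp only [lpProj_eq_dyadicMul, dyadicMul_dyadicMul hφ.isAnnularSymbol hm]
  have h := TemperedDistribution.fourierMultiplierCLM_sum (EuclideanSpace ℂ (Fin d))
    (s := Finset.Icc (-2 : ℤ) 2)
    (g := fun i => dyadicSymbol m j * dyadicSymbol (fun ξ => (φ ξ : ℂ)) (j + i))
    (fun i _ => (hm.hasTemperateGrowth_dyadicSymbol j).mul
      (hφ.isAnnularSymbol.hasTemperateGrowth_dyadicSymbol (j + i)))
  have h2 := congrArg (fun T => T f) h
  simp only [sum_apply] at h2
  rw [← h2, dyadicMul]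
  congr 2
  ext ξ
  simp only [Pi.mul_apply, dyadicSymbol]
  rw [← Finset.mul_sum]
  by_cases h0 : m ((2 : ℝ) ^ (-j) • (2 * Real.pi) • ξ) = 0
  · rw [h0, zero_mul]
  obtain ⟨h1, h2⟩ := hm.support _ h0
  have := hφ.sum_apply_zpow_smul h1 h2
  have h3 : ∀ i : ℤ, (2 : ℝ) ^ (-(j + i)) • (2 * Real.pi) • ξ =
      (2 : ℝ) ^ (-i) • (2 : ℝ) ^ (-j) • (2 * Real.pi) • ξ := fun i => by
    rw [smul_smul ((2 : ℝ) ^ (-i)), ← zpow_add₀ two_ne_zero, neg_add_rev]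
  simp only [h3]
  rw [← Complex.ofReal_sum, this, Complex.ofReal_one, mul_one]

end IsLittlewoodPaley

/-- The sum of three consecutive dilates of `φ`, which equals one on the support of `φ`. -/
noncomputable def fatten (φ : EuclideanSpace ℝ (Fin d) → ℝ) (ξ : EuclideanSpace ℝ (Fin d)) : ℝ :=
  ∑ i ∈ Finset.Icc (-1 : ℤ) 1, φ ((2 : ℝ) ^ (-i) • ξ)

namespace IsLittlewoodPaley

theorem isAnnularSymbol_fatten (hφ : IsLittlewoodPaley φ) :
    IsAnnularSymbol fun ξ => (fatten φ ξ : ℂ) := by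
  have hs : ContDiff ℝ (⊤ : ℕ∞) (fatten φ) := by
    unfold fatten
    exact ContDiff.sum fun (i : ℤ) _ => hφ.smooth.comp (contDiff_const_smul ((2 : ℝ) ^ (-i)))
  refine ⟨Complex.ofRealCLM.contDiff.comp hs, fun ξ hξ => ?_⟩
  · have h : fatten φ ξ ≠ 0 := by exact_mod_cast hξ
    obtain ⟨i, hi, hi'⟩ := Finset.exists_ne_zero_of_sum_ne_zero h
    have h3 := hφ.support _ hi'
    rw [norm_smul, norm_zpow, Real.norm_ofNat] at h3
    rw [Finset.mem_Icc] at hi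
    have h4 : i = -1 ∨ i = 0 ∨ i = 1 := by omega
    rcases h4 with rfl | rfl | rfl <;> norm_num at h3 <;> constructor <;> linarith [h3.1, h3.2]

theorem fatten_mul_self (hφ : IsLittlewoodPaley φ) (ξ : EuclideanSpace ℝ (Fin d)) :
    fatten φ ξ * φ ξ = φ ξ := by
  by_cases h0 : φ ξ = 0
  · rw [h0, mul_zero]
  have h1 := hφ.support ξ h0
  have h2 := hφ.sum_apply_zpow_smul (ξ := ξ) (by linarith [h1.1]) (by linarith [h1.2])
  have h3 : fatten φ ξ = 1 := by
    rw [← h2, fatten]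
    refine Finset.sum_subset (Finset.Icc_subset_Icc (by norm_num) (by norm_num)) fun i hi hi' => ?_
    by_contra h
    have h3 := hφ.support _ h
    rw [norm_smul, norm_zpow, Real.norm_ofNat] at h3
    rw [Finset.mem_Icc] at hi hi'
    have h4 : i = -2 ∨ i = 2 := by omega
    rcases h4 with rfl | rfl <;> norm_num at h3 <;> linarith [h3.1, h3.2, h1.1, h1.2]
  rw [h3, one_mul]

/-- The reproducing identity lets Bernstein's inequality bound a block by its own L^p norm. -/
theorem dyadicMul_fatten_lpProj (hφ : IsLittlewoodPaley φ) (j : ℤ) (f : VectorDistribution d) :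
    dyadicMul (fun ξ => (fatten φ ξ : ℂ)) j (lpProj φ j f) = lpProj φ j f := by
  rw [lpProj_eq_dyadicMul, dyadicMul_dyadicMul hφ.isAnnularSymbol_fatten hφ.isAnnularSymbol,
    dyadicMul]
  congr 2
  ext ξ
  simp only [Pi.mul_apply, dyadicSymbol]
  rw [← Complex.ofReal_mul, mul_comm, hφ.fatten_mul_self]

end IsLittlewoodPaley

end LittlewoodPaley

/-! ### The localized Leray projector -/

section Leray

variable {d : ℕ} {φ : EuclideanSpace ℝ (Fin d) → ℝ}

/-- The matrix entries of the symbol of the Leray projector, localized by the fattened `φ`. -/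
noncomputable def lerayEntry (φ : EuclideanSpace ℝ (Fin d) → ℝ) (a b : Fin d)
    (ξ : EuclideanSpace ℝ (Fin d)) : ℝ :=
  ((if a = b then 1 else 0) - ξ a * ξ b / ‖ξ‖ ^ 2) * fatten φ ξ

theorem IsLittlewoodPaley.isAnnularSymbol_lerayEntry (hφ : IsLittlewoodPaley φ) (a b : Fin d) :
    IsAnnularSymbol fun ξ => (lerayEntry φ a b ξ : ℂ) := by
  have h := hφ.isAnnularSymbol_fatten.mul_of_contDiffAt
    (h := fun ξ => (((if a = b then 1 else 0) - ξ a * ξ b / ‖ξ‖ ^ 2 : ℝ) : ℂ)) (fun ξ hξ => by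
      refine Complex.ofRealCLM.contDiff.contDiffAt.comp ξ ?_
      have hn : ‖ξ‖ ^ 2 ≠ 0 := by simpa using hξ
      refine contDiffAt_const.sub (ContDiffAt.div ?_ (contDiff_norm_sq ℝ).contDiffAt hn)
      fun_prop)
  simpa only [lerayEntry, Complex.ofReal_mul] using h

/-- The matrix unit sending the coordinate `b` to the coordinate `a`. -/
noncomputable def matrixUnit (a b : Fin d) :
    EuclideanSpace ℂ (Fin d) →L[ℂ] EuclideanSpace ℂ (Fin d) :=
  (EuclideanSpace.proj b : EuclideanSpace ℂ (Fin d) →L[ℂ] ℂ).smulRight (EuclideanSpace.single a 1)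

theorem matrixUnit_apply (a b : Fin d) (v : EuclideanSpace ℂ (Fin d)) (i : Fin d) :
    matrixUnit a b v i = if i = a then v b else 0 := by
  simp [matrixUnit]

theorem norm_matrixUnit_le (a b : Fin d) (v : EuclideanSpace ℂ (Fin d)) :
    ‖matrixUnit a b v‖ ≤ ‖v‖ := by
  simpa [matrixUnit, norm_smul] using PiLp.norm_apply_le v b

/-- The Leray projector localized at frequency `2 ^ j`. -/
noncomputable def lerayProj (φ : EuclideanSpace ℝ (Fin d) → ℝ) (j : ℤ)
    (f : VectorDistribution d) : VectorDistribution d :=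
  ∑ a, ∑ b, mapValues (matrixUnit a b) (dyadicMul (fun ξ => (lerayEntry φ a b ξ : ℂ)) j f)

theorem lerayProj_apply (φ : EuclideanSpace ℝ (Fin d) → ℝ) (j : ℤ) (f : VectorDistribution d)
    (u : 𝓢(EuclideanSpace ℝ (Fin d), ℂ)) (i : Fin d) :
    lerayProj φ j f u i =
      ∑ b, dyadicMul (fun ξ => (lerayEntry φ i b ξ : ℂ)) j f u b := by
  simp [lerayProj, mapValues_apply, matrixUnit_apply]

theorem lerayProj_add (φ : EuclideanSpace ℝ (Fin d) → ℝ) (j : ℤ) (f g : VectorDistribution d) :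
    lerayProj φ j (f + g) = lerayProj φ j f + lerayProj φ j g := by
  simp only [lerayProj, map_add, Finset.sum_add_distrib]

theorem IsLittlewoodPaley.exists_distLpNorm_lerayProj_le (hφ : IsLittlewoodPaley φ) :
    ∃ C : ℝ≥0∞, C < ∞ ∧ ∀ (j : ℤ) (r : ℝ) (_ : 1 < r) (f : VectorDistribution d),
      distLpNorm (ENNReal.ofReal r) (lerayProj φ j f) ≤ C * distLpNorm (ENNReal.ofReal r) f := by
  choose C hC h using fun a b =>
    exists_distLpNorm_dyadicMul_le (hφ.isAnnularSymbol_lerayEntry a b)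
  refine ⟨∑ a, ∑ b, C a b, ?_, fun j r hr f => ?_⟩
  · exact ENNReal.sum_lt_top.2 fun a _ => ENNReal.sum_lt_top.2 fun b _ => hC a b
  have h1 := one_le_ofReal_of_one_lt hr
  rw [Finset.sum_mul]
  refine (distLpNorm_sum_le h1 _ _).trans (Finset.sum_le_sum fun a _ => ?_)
  rw [Finset.sum_mul]
  refine (distLpNorm_sum_le h1 _ _).trans (Finset.sum_le_sum fun b _ => ?_)
  exact (distLpNorm_mapValues_le h1 (norm_matrixUnit_le a b) _).trans (h a b j r hr f)

theorem IsLittlewoodPaley.lpProj_lerayProj_eq_zero (hφ : IsLittlewoodPaley φ) {i : ℤ}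
    (hi : i ∉ Finset.Icc (-2 : ℤ) 2) (j : ℤ) (f : VectorDistribution d) :
    lpProj φ (j + i) (lerayProj φ j f) = 0 := by
  simp only [lerayProj, lpProj_eq_dyadicMul, map_sum, dyadicMul_mapValues]
  refine Finset.sum_eq_zero fun a _ => Finset.sum_eq_zero fun b _ => ?_
  rw [← lpProj_eq_dyadicMul,
    hφ.lpProj_dyadicMul_eq_zero (hφ.isAnnularSymbol_lerayEntry a b) hi, map_zero]

theorem IsLittlewoodPaley.sum_lpProj_lerayProj (hφ : IsLittlewoodPaley φ) (j : ℤ)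
    (f : VectorDistribution d) :
    ∑ i ∈ Finset.Icc (-2 : ℤ) 2, lpProj φ (j + i) (lerayProj φ j f) = lerayProj φ j f := by
  simp only [lerayProj, lpProj_eq_dyadicMul, map_sum, dyadicMul_mapValues]
  rw [Finset.sum_comm]
  refine Finset.sum_congr rfl fun a _ => ?_
  rw [Finset.sum_comm]
  refine Finset.sum_congr rfl fun b _ => ?_
  rw [← map_sum]
  congr 1
  exact hφ.sum_lpProj_dyadicMul (hφ.isAnnularSymbol_lerayEntry a b) j f

/-- The columns of I - ξξᵀ/|ξ|² are orthogonal to ξ. -/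
theorem sum_lerayEntry_mul (φ : EuclideanSpace ℝ (Fin d) → ℝ) (b : Fin d)
    (ξ : EuclideanSpace ℝ (Fin d)) : ∑ a, lerayEntry φ a b ξ * ξ a = 0 := by
  by_cases h0 : ξ = 0
  · simp [h0]
  have hn : ‖ξ‖ ^ 2 ≠ 0 := by simpa using h0
  have h1 : ∑ a, ξ a * ξ a = ‖ξ‖ ^ 2 := by
    rw [EuclideanSpace.real_norm_sq_eq]
    exact Finset.sum_congr rfl fun a _ => (sq _).symm
  have h2 : ∀ a, lerayEntry φ a b ξ * ξ a =
      fatten φ ξ * ((if a = b then ξ a else 0) - ξ b / ‖ξ‖ ^ 2 * (ξ a * ξ a)) := fun a => by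
    rw [lerayEntry]
    split_ifs <;> ring
  simp only [h2]
  rw [← Finset.mul_sum, Finset.sum_sub_distrib, ← Finset.mul_sum, h1, div_mul_cancel₀ _ hn]
  simp

/-- With derivative and multiplier both moved to the test function, each component b of f meets a
symbol proportional to ∑_a m_{ab}(cξ) ξ_a = 0. -/
theorem IsLittlewoodPaley.isDivFree_lerayProj (hφ : IsLittlewoodPaley φ) (j : ℤ)
    (f : VectorDistribution d) : IsDivFree (lerayProj φ j f) := by
  intro u
  simp only [TemperedDistribution.lineDerivOp_apply_apply, lerayProj_apply, dyadicMul_apply]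
  rw [Finset.sum_comm]
  refine Finset.sum_eq_zero fun b _ => ?_
  have key : ∑ i, 𝓕 (SchwartzMap.smulLeftCLM ℂ
      (dyadicSymbol (fun ξ => (lerayEntry φ i b ξ : ℂ)) j)
      (𝓕⁻ (-∂_{EuclideanSpace.single i (1 : ℝ)} u))) = 0 := by
    have hz : ∑ i, SchwartzMap.smulLeftCLM ℂ
        (dyadicSymbol (fun ξ => (lerayEntry φ i b ξ : ℂ)) j)
        (𝓕⁻ (-∂_{EuclideanSpace.single i (1 : ℝ)} u)) = 0 := by
      ext ξ
      have h1 := sum_lerayEntry_mul φ b (((2 : ℝ) ^ (-j) * (2 * Real.pi)) • ξ)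
      have h2 : ∑ i, lerayEntry φ i b (((2 : ℝ) ^ (-j) * (2 * Real.pi)) • ξ) * ξ i = 0 := by
        refine (mul_eq_zero.1 ?_).resolve_left (dyadicScale_pos j).ne'
        rw [← h1, Finset.mul_sum]
        refine Finset.sum_congr rfl fun i _ => ?_
        rw [PiLp.smul_apply, smul_eq_mul]
        ring
      rw [_root_.sum_apply, _root_.zero_apply]
      have h3 : ∀ i, (SchwartzMap.smulLeftCLM ℂ
          (dyadicSymbol (fun ξ => (lerayEntry φ i b ξ : ℂ)) j)
          (𝓕⁻ (-∂_{EuclideanSpace.single i (1 : ℝ)} u))) ξ =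
          ((lerayEntry φ i b (((2 : ℝ) ^ (-j) * (2 * Real.pi)) • ξ) * ξ i : ℝ) : ℂ) *
            (2 * Real.pi * Complex.I * 𝓕⁻ u ξ) := fun i => by
        rw [SchwartzMap.smulLeftCLM_apply_apply
          ((hφ.isAnnularSymbol_lerayEntry i b).hasTemperateGrowth_dyadicSymbol j),
          FourierTransform.fourierInv_neg, SchwartzMap.fourierInv_lineDerivOp_eq, dyadicSymbol_eq,
          _root_.neg_apply, _root_.smul_apply,
          SchwartzMap.smulLeftCLM_apply_apply (by fun_prop)]
        simp [EuclideanSpace.inner_single_right]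
        ring
      simp only [h3]
      rw [← Finset.sum_mul, ← Complex.ofReal_sum, h2, Complex.ofReal_zero, zero_mul]
    change ∑ i, FourierTransform.fourierCLM ℂ 𝓢(EuclideanSpace ℝ (Fin d), ℂ) _ = 0
    rw [← map_sum, hz, map_zero]
  have := congrArg (fun v => f v b) key
  simpa using this

/-- The defect has a-th component with symbol (ξ_a/|ξ|²) φ(ξ) ξ·ĝ up to dilation. Transposed, it is
a multiple of div g tested against the single function v = q(2⁻ʲD)u, where q = (ξ_a/|ξ|²) φ. -/
theorem IsLittlewoodPaley.lerayProj_lpProj (hφ : IsLittlewoodPaley φ) (j : ℤ)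
    {g : VectorDistribution d} (hg : IsDivFree g) :
    lerayProj φ j (lpProj φ j g) = lpProj φ j g := by
  ext u a
  have hc := dyadicScale_pos j
  set c := (2 : ℝ) ^ (-j) * (2 * Real.pi) with hcdef
  have hpi := Real.pi_ne_zero
  let q : EuclideanSpace ℝ (Fin d) → ℂ := fun ξ => ((ξ a / ‖ξ‖ ^ 2 : ℝ) : ℂ) * (φ ξ : ℂ)
  have hq : IsAnnularSymbol q := hφ.isAnnularSymbol.mul_of_contDiffAt fun ξ hξ => by
    refine Complex.ofRealCLM.contDiff.contDiffAt.comp ξ ?_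
    have hn : ‖ξ‖ ^ 2 ≠ 0 := by simpa using hξ
    refine ContDiffAt.div ?_ (contDiff_norm_sq ℝ).contDiffAt hn
    fun_prop
  let v : 𝓢(EuclideanSpace ℝ (Fin d), ℂ) :=
    𝓕 (SchwartzMap.smulLeftCLM ℂ (dyadicSymbol q j) (𝓕⁻ u))
  -- The derivative of a Fourier transform produces -2πi ξ_b, whereas the dilated symbol contains c
  -- ξ_b; this explains the factor c/(2πi).
  have hterm : ∀ b, 𝓕 (SchwartzMap.smulLeftCLM ℂ (dyadicSymbol (fun ξ => (φ ξ : ℂ)) j)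
      (𝓕⁻ (𝓕 (SchwartzMap.smulLeftCLM ℂ (dyadicSymbol (fun ξ => (lerayEntry φ a b ξ : ℂ)) j)
        (𝓕⁻ u))))) = (if a = b then (1 : ℂ) else 0) •
          𝓕 (SchwartzMap.smulLeftCLM ℂ (dyadicSymbol (fun ξ => (φ ξ : ℂ)) j) (𝓕⁻ u)) -
        ((c : ℂ) / (2 * Real.pi * Complex.I)) • (-∂_{EuclideanSpace.single b (1 : ℝ)} v) := by
    intro b
    rw [SchwartzMap.lineDerivOp_fourier_eq, ← FourierTransform.fourier_neg,
      ← FourierTransform.fourier_smul, ← FourierTransform.fourier_smul,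
      FourierTransform.fourierInv_fourier_eq]
    simp only [← FourierTransform.fourierCLM_apply (R := ℂ)]
    rw [← map_sub]
    congr 1
    ext ξ
    rw [_root_.sub_apply, _root_.smul_apply, _root_.smul_apply,
      _root_.neg_apply, _root_.smul_apply,
      SchwartzMap.smulLeftCLM_apply_apply (by fun_prop : (inner ℝ · _).HasTemperateGrowth),
      SchwartzMap.smulLeftCLM_apply_apply (hφ.isAnnularSymbol.hasTemperateGrowth_dyadicSymbol j),
      SchwartzMap.smulLeftCLM_apply_apply (hφ.isAnnularSymbol.hasTemperateGrowth_dyadicSymbol j),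
      SchwartzMap.smulLeftCLM_apply_apply
        ((hφ.isAnnularSymbol_lerayEntry a b).hasTemperateGrowth_dyadicSymbol j),
      SchwartzMap.smulLeftCLM_apply_apply (hq.hasTemperateGrowth_dyadicSymbol j)]
    simp only [dyadicSymbol_eq, ← hcdef, q, smul_eq_mul, lerayEntry]
    have hfat : (fatten φ (c • ξ) : ℂ) * (φ (c • ξ) : ℂ) = (φ (c • ξ) : ℂ) := by
      exact_mod_cast hφ.fatten_mul_self (c • ξ)
    have hb : ((c • ξ) b : ℂ) = (c : ℂ) * (ξ b : ℂ) := by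
      rw [PiLp.smul_apply, smul_eq_mul, Complex.ofReal_mul]
    have hin : inner ℝ ξ (EuclideanSpace.single b (1 : ℝ)) = ξ b := by
      simp [EuclideanSpace.inner_single_right]
    have hI : (2 * Real.pi * Complex.I : ℂ) ≠ 0 := by
      simp [hpi]
    have hδ : (((if a = b then 1 else 0 : ℝ)) : ℂ) = if a = b then 1 else 0 := by
      split_ifs <;> simp
    rw [hin, Complex.ofReal_mul, Complex.ofReal_sub, hδ, Complex.ofReal_div, Complex.ofReal_mul,
      Complex.ofReal_div, hb, Complex.real_smul]
    have hcancel : ∀ z : ℂ, (c : ℂ) / (2 * Real.pi * Complex.I) *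
        -(-(2 * Real.pi * Complex.I) * z) = c * z := fun z => by
      field_simp
    rw [hcancel]
    linear_combination ((if a = b then 1 else 0) -
      ((c • ξ) a : ℂ) * (c * ξ b) / ((‖c • ξ‖ ^ 2 : ℝ) : ℂ)) * (𝓕⁻ u) ξ * hfat
  have hdiv : ∑ b, g (-∂_{EuclideanSpace.single b (1 : ℝ)} v) b = 0 := hg v
  rw [lerayProj_apply]
  simp only [lpProj_eq_dyadicMul, dyadicMul_apply, hterm, map_sub, map_smul, PiLp.sub_apply,
    PiLp.smul_apply, Finset.sum_sub_distrib, smul_eq_mul]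
  rw [← Finset.mul_sum, hdiv]
  simp

end Leray

/-! ### Real-valuedness and vanishing divergence -/

section RealValued

variable {d : ℕ} {φ : EuclideanSpace ℝ (Fin d) → ℝ}

theorem fourier_im_eq_zero {S : EuclideanSpace ℝ (Fin d) → ℝ} (hS : ∀ ξ, S (-ξ) = S ξ)
    (x : EuclideanSpace ℝ (Fin d)) : (𝓕 (fun ξ => (S ξ : ℂ)) x).im = 0 := by
  rw [← Complex.conj_eq_iff_im, Real.fourier_eq, ← integral_conj,
    ← integral_neg_eq_self (fun v => Real.fourierChar (-inner ℝ v x) • (S v : ℂ)) volume]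
  refine integral_congr_ae (Filter.Eventually.of_forall fun ξ => ?_)
  simp only [Circle.smul_def, smul_eq_mul, map_mul, Complex.conj_ofReal, hS, inner_neg_left,
    neg_neg]
  rw [← Circle.coe_inv_eq_conj, ← AddChar.map_neg_eq_inv, neg_neg]

/-- A real even symbol has a real kernel, so the multiplier maps real test functions to real ones.
-/
theorem im_fourier_smulLeft_fourierInv {m : EuclideanSpace ℝ (Fin d) → ℝ}
    (hm : IsAnnularSymbol fun ξ => (m ξ : ℂ)) (hev : ∀ ξ, m (-ξ) = m ξ) (j : ℤ)
    {u : 𝓢(EuclideanSpace ℝ (Fin d), ℂ)} (hu : ∀ x, (u x).im = 0)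
    (y : EuclideanSpace ℝ (Fin d)) :
    (𝓕 (SchwartzMap.smulLeftCLM ℂ (dyadicSymbol (fun ξ => (m ξ : ℂ)) j) (𝓕⁻ u)) y).im = 0 := by
  have h := fourier_smulLeft_fourierInv_apply
    ((hm.hasCompactSupport_dyadicSymbol j).toSchwartzMap (hm.contDiff_dyadicSymbol j)) u y
  have hcoe : ⇑((hm.hasCompactSupport_dyadicSymbol j).toSchwartzMap
    (hm.contDiff_dyadicSymbol j)) = dyadicSymbol (fun ξ => (m ξ : ℂ)) j := rfl
  rw [hcoe] at h
  rw [h, SchwartzMap.fourier_coe, hcoe, ← Complex.conj_eq_iff_im, ← integral_conj]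
  refine integral_congr_ae (Filter.Eventually.of_forall fun x => ?_)
  have h1 : (𝓕 (dyadicSymbol (fun ξ => (m ξ : ℂ)) j) (y - x)).im = 0 :=
    fourier_im_eq_zero (S := fun ξ => m ((2 : ℝ) ^ (-j) • (2 * Real.pi) • ξ))
      (fun ξ => by rw [smul_neg, smul_neg, hev]) (y - x)
  simp only [map_mul]
  rw [Complex.conj_eq_iff_im.2 h1, Complex.conj_eq_iff_im.2 (hu x)]

theorem IsRealValued.dyadicMul {f : VectorDistribution d} (hf : IsRealValued f)
    {m : EuclideanSpace ℝ (Fin d) → ℝ} (hm : IsAnnularSymbol fun ξ => (m ξ : ℂ))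
    (hev : ∀ ξ, m (-ξ) = m ξ) (j : ℤ) :
    IsRealValued (dyadicMul (fun ξ => (m ξ : ℂ)) j f) := fun _ hu i =>
  hf _ (im_fourier_smulLeft_fourierInv hm hev j hu) i

theorem IsLittlewoodPaley.even (hφ : IsLittlewoodPaley φ) (ξ : EuclideanSpace ℝ (Fin d)) :
    φ (-ξ) = φ ξ := hφ.radial _ _ (norm_neg ξ)

theorem IsRealValued.lpProj (hφ : IsLittlewoodPaley φ) {f : VectorDistribution d}
    (hf : IsRealValued f) (j : ℤ) : IsRealValued (lpProj φ j f) :=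
  hf.dyadicMul hφ.isAnnularSymbol hφ.even j

theorem IsRealValued.lerayProj (hφ : IsLittlewoodPaley φ) {f : VectorDistribution d}
    (hf : IsRealValued f) (j : ℤ) : IsRealValued (lerayProj φ j f) := by
  intro u hu i
  rw [lerayProj_apply, Complex.im_sum]
  refine Finset.sum_eq_zero fun b _ => ?_
  refine hf.dyadicMul (hφ.isAnnularSymbol_lerayEntry i b) (fun ξ => ?_) j u hu b
  simp [lerayEntry, fatten, hφ.even]

theorem IsRealValued.sub {f g : VectorDistribution d} (hf : IsRealValued f)
    (hg : IsRealValued g) : IsRealValued (f - g) := fun u hu i => by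
  have : (f - g) u i = f u i - g u i := rfl
  rw [this, Complex.sub_im, hf u hu i, hg u hu i, sub_zero]

theorem hasSum_apply_apply {ι : Type*} {f : ι → VectorDistribution d} {g : VectorDistribution d}
    (h : HasSum f g) (u : 𝓢(EuclideanSpace ℝ (Fin d), ℂ)) (i : Fin d) :
    HasSum (fun k => f k u i) (g u i) :=
  h.mapL ((EuclideanSpace.proj i : EuclideanSpace ℂ (Fin d) →L[ℂ] ℂ) ∘L
    PointwiseConvergenceCLM.evalCLM (RingHom.id ℂ) (EuclideanSpace ℂ (Fin d)) u)

theorem IsRealValued.of_hasSum {ι : Type*} {f : ι → VectorDistribution d}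
    {g : VectorDistribution d} (h : HasSum f g) (hf : ∀ k, IsRealValued (f k)) :
    IsRealValued g := fun u hu i => by
  have h1 := (hasSum_apply_apply h u i).mapL Complex.imCLM
  simp only [Complex.imCLM_apply, fun k => hf k u hu i] at h1
  exact h1.unique hasSum_zero

theorem IsDivFree.of_hasSum {ι : Type*} {f : ι → VectorDistribution d}
    {g : VectorDistribution d} (h : HasSum f g) (hf : ∀ k, IsDivFree (f k)) :
    IsDivFree g := fun u => by
  have h1 := hasSum_sum (s := Finset.univ) fun i _ =>
    hasSum_apply_apply h (-∂_{EuclideanSpace.single i (1 : ℝ)} u) i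
  have h2 : ∀ k, ∑ i, f k (-∂_{EuclideanSpace.single i (1 : ℝ)} u) i = 0 := fun k => hf k u
  simp only [h2] at h1
  exact h1.unique hasSum_zero

theorem IsDivFree.sub {f g : VectorDistribution d} (hf : IsDivFree f) (hg : IsDivFree g) :
    IsDivFree (f - g) := fun u => by
  have : ∀ i : Fin d, (∂_{EuclideanSpace.single i (1 : ℝ)} (f - g)) u i =
    (∂_{EuclideanSpace.single i (1 : ℝ)} f) u i - (∂_{EuclideanSpace.single i (1 : ℝ)} g) u i :=
    fun i => rfl
  simp only [this, Finset.sum_sub_distrib]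
  rw [hf u, hg u, sub_zero]

/-- The function representing a real-valued distribution is real almost everywhere. -/
theorem IsRealValued.ae_im_eq_zero {f : VectorDistribution d} (hf : IsRealValued f) {p : ℝ≥0∞}
    (hp : 1 ≤ p) {F : EuclideanSpace ℝ (Fin d) → EuclideanSpace ℂ (Fin d)} (hF : MemLp F p volume)
    (h : ∀ u : 𝓢(EuclideanSpace ℝ (Fin d), ℂ), f u = ∫ x, u x • F x) :
    ∀ᵐ x, ∀ i, (F x i).im = 0 := by
  rw [ae_all_iff]
  intro i
  let L : EuclideanSpace ℂ (Fin d) →L[ℝ] ℝ := Complex.imCLM ∘L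
    (EuclideanSpace.proj i : EuclideanSpace ℂ (Fin d) →L[ℂ] ℂ).restrictScalars ℝ
  have hl : LocallyIntegrable (fun x => L (F x)) volume :=
    (L.comp_memLp' hF).locallyIntegrable hp
  refine ae_eq_zero_of_integral_contDiff_smul_eq_zero hl fun g hg hgc => ?_
  have hg₁ : HasCompactSupport (Complex.ofRealCLM ∘ g) := hgc.comp_left rfl
  have hg₂ : ContDiff ℝ (⊤ : ℕ∞) (Complex.ofRealCLM ∘ g) := by fun_prop
  have h1 := hf (hg₁.toSchwartzMap hg₂) (fun x => by simp) i
  have h2 : L (f (hg₁.toSchwartzMap hg₂)) = 0 := h1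
  rw [h, ← L.integral_comp_comm (integrable_schwartz_smul hp hF _)] at h2
  rw [← h2]
  refine integral_congr_ae (Filter.Eventually.of_forall fun x => ?_)
  simp [L]

theorem isRealValued_of_ae_im_eq_zero {f : VectorDistribution d} {p : ℝ≥0∞}
    (hp : 1 ≤ p) {F : EuclideanSpace ℝ (Fin d) → EuclideanSpace ℂ (Fin d)} (hF : MemLp F p volume)
    (h : ∀ u : 𝓢(EuclideanSpace ℝ (Fin d), ℂ), f u = ∫ x, u x • F x)
    (hre : ∀ᵐ x, ∀ i, (F x i).im = 0) : IsRealValued f := by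
  intro u hu i
  let L : EuclideanSpace ℂ (Fin d) →L[ℝ] ℝ := Complex.imCLM ∘L
    (EuclideanSpace.proj i : EuclideanSpace ℂ (Fin d) →L[ℂ] ℂ).restrictScalars ℝ
  change L (f u) = 0
  rw [h, ← L.integral_comp_comm (integrable_schwartz_smul hp hF _)]
  refine integral_eq_zero_of_ae ?_
  filter_upwards [hre] with x hx
  simp [L, hu x, hx i]

end RealValued

/-! ### Truncation and interpolation -/

section Truncation

variable {d : ℕ}

theorem exists_distribution_of_memLp {p : ℝ≥0∞} (hp : 1 ≤ p)
    {F : EuclideanSpace ℝ (Fin d) → EuclideanSpace ℂ (Fin d)} (hF : MemLp F p volume) :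
    ∃ f : VectorDistribution d, ∀ u : 𝓢(EuclideanSpace ℝ (Fin d), ℂ), f u = ∫ x, u x • F x := by
  have : Fact (1 ≤ p) := ⟨hp⟩
  refine ⟨Lp.toTemperedDistribution (hF.toLp F), fun u => ?_⟩
  rw [Lp.toTemperedDistribution_apply]
  refine integral_congr_ae ?_
  filter_upwards [hF.coeFn_toLp] with x hx
  rw [hx]

/-- Interpolation of `L^(2 p)` between `L^p` and `L^∞`. -/
theorem eLpNorm_two_mul_le {α V : Type*} [MeasurableSpace α] {μ : Measure α}
    [NormedAddCommGroup V] {B : α → V} {p : ℝ} (hp : 0 < p) {Λ : ℝ≥0∞}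
    (hΛ : Λ ≠ ∞) (hB : ∀ᵐ x ∂μ, ‖B x‖ₑ ≤ Λ) :
    eLpNorm B (ENNReal.ofReal (2 * p)) μ ≤
      Λ ^ (1 / 2 : ℝ) * eLpNorm B (ENNReal.ofReal p) μ ^ (1 / 2 : ℝ) := by
  rw [eLpNorm_eq_lintegral_rpow_enorm_toReal (by simpa using hp) ENNReal.ofReal_ne_top,
    eLpNorm_eq_lintegral_rpow_enorm_toReal (by simpa using hp) ENNReal.ofReal_ne_top,
    ENNReal.toReal_ofReal (by positivity), ENNReal.toReal_ofReal hp.le]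
  have h1 : ∫⁻ x, ‖B x‖ₑ ^ (2 * p) ∂μ ≤ Λ ^ p * ∫⁻ x, ‖B x‖ₑ ^ p ∂μ := by
    rw [← lintegral_const_mul' _ _ (ENNReal.rpow_ne_top_of_nonneg hp.le hΛ)]
    refine lintegral_mono_ae ?_
    filter_upwards [hB] with x hx
    rw [two_mul, ENNReal.rpow_add_of_nonneg _ _ hp.le hp.le]
    gcongr
  calc (∫⁻ x, ‖B x‖ₑ ^ (2 * p) ∂μ) ^ (1 / (2 * p))
      ≤ (Λ ^ p * ∫⁻ x, ‖B x‖ₑ ^ p ∂μ) ^ (1 / (2 * p)) := by gcongr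
    _ = _ := by
        rw [ENNReal.mul_rpow_of_nonneg _ _ (by positivity), ← ENNReal.rpow_mul, ← ENNReal.rpow_mul]
        congr 2 <;> field_simp

theorem distLpNorm_two_mul_le {f : VectorDistribution d} {p : ℝ} (hp : 1 < p)
    (hf : distLpNorm (ENNReal.ofReal p) f < ∞) (hf' : distLpNorm ∞ f < ∞) :
    distLpNorm (ENNReal.ofReal (2 * p)) f ≤
      distLpNorm ∞ f ^ (1 / 2 : ℝ) * distLpNorm (ENNReal.ofReal p) f ^ (1 / 2 : ℝ) := by
  have hp1 := one_le_ofReal_of_one_lt hp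
  obtain ⟨F, hF, hF', hFn⟩ := exists_eLpNorm_eq_distLpNorm hp1 hf
  obtain ⟨G, hG, hG', hGn⟩ := exists_eLpNorm_eq_distLpNorm le_top hf'
  have hFG : F =ᵐ[volume] G := ae_eq_of_forall_integral_smul_eq hp1 le_top hF hG fun u =>
    (hF' u).symm.trans (hG' u)
  have hle := eLpNorm_two_mul_le (μ := volume) (B := F) (p := p) (by linarith)
    (Λ := distLpNorm ∞ f) hf'.ne (by
      filter_upwards [hFG, enorm_ae_le_eLpNormEssSup G volume] with x hx hx'
      rw [hx, ← hGn, eLpNorm_exponent_top]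
      exact hx')
  rw [← hFn]
  refine (distLpNorm_le_eLpNorm ⟨hF.1, hle.trans_lt ?_⟩ hF').trans hle
  exact ENNReal.mul_lt_top (ENNReal.rpow_lt_top_of_nonneg (by norm_num) hf'.ne)
    (ENNReal.rpow_lt_top_of_nonneg (by norm_num) (hFn ▸ hf.ne))

/-- Where |F| > l one has |F|² ≤ l^{2-p} |F|^p, because p > 2. -/
theorem eLpNorm_indicator_two_le {α V : Type*} [MeasurableSpace α] {μ : Measure α}
    [NormedAddCommGroup V] {F : α → V} {p : ℝ} (hp : 2 < p) {l : ℝ} (hl : 0 < l) :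
    eLpNorm ({x | l < ‖F x‖}.indicator F) 2 μ ≤
      ENNReal.ofReal (l ^ (1 - p / 2)) * eLpNorm F (ENNReal.ofReal p) μ ^ (p / 2) := by
  have hp0 : 0 < p := by linarith
  rw [eLpNorm_eq_lintegral_rpow_enorm_toReal two_ne_zero ENNReal.ofNat_ne_top,
    eLpNorm_eq_lintegral_rpow_enorm_toReal (by simpa using hp0) ENNReal.ofReal_ne_top,
    ENNReal.toReal_ofReal hp0.le, ENNReal.toReal_ofNat]
  have h1 : ∫⁻ x, ‖{x | l < ‖F x‖}.indicator F x‖ₑ ^ (2 : ℝ) ∂μ ≤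
      ENNReal.ofReal (l ^ (2 - p)) * ∫⁻ x, ‖F x‖ₑ ^ p ∂μ := by
    rw [← lintegral_const_mul' _ _ ENNReal.ofReal_ne_top]
    refine lintegral_mono fun x => ?_
    by_cases hx : l < ‖F x‖
    · rw [Set.indicator_of_mem (by exact hx), ← ofReal_norm,
        ENNReal.ofReal_rpow_of_nonneg (norm_nonneg _) zero_le_two,
        ENNReal.ofReal_rpow_of_nonneg (norm_nonneg _) hp0.le, ← ENNReal.ofReal_mul (by positivity)]
      refine ENNReal.ofReal_le_ofReal ?_
      have hpos : 0 < ‖F x‖ := hl.trans hx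
      calc ‖F x‖ ^ (2 : ℝ) = ‖F x‖ ^ (2 - p) * ‖F x‖ ^ p := by
            rw [← Real.rpow_add hpos]; congr 1; ring
        _ ≤ l ^ (2 - p) * ‖F x‖ ^ p := by
            exact mul_le_mul_of_nonneg_right
              (Real.rpow_le_rpow_of_nonpos hl hx.le (by linarith)) (by positivity)
    · rw [Set.indicator_of_notMem (by exact hx), enorm_zero, ENNReal.zero_rpow_of_pos two_pos]
      exact bot_le
  calc _ ≤ (ENNReal.ofReal (l ^ (2 - p)) * ∫⁻ x, ‖F x‖ₑ ^ p ∂μ) ^ (1 / 2 : ℝ) := by gcongr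
    _ = _ := by
        rw [ENNReal.mul_rpow_of_nonneg _ _ (by positivity),
          ENNReal.ofReal_rpow_of_nonneg (by positivity) (by positivity), ← Real.rpow_mul hl.le,
          ← ENNReal.rpow_mul]
        congr 3 <;> field_simp

/-- Splitting of a distribution in `L^p` at height `l` into an `L^2` and an `L^(2 p)` part. -/
theorem exists_truncation {f : VectorDistribution d} (hf : IsRealValued f) {p : ℝ} (hp : 2 < p)
    (hfp : distLpNorm (ENNReal.ofReal p) f < ∞) {l : ℝ} (hl : 0 < l) :
    ∃ h b : VectorDistribution d, f = h + b ∧ IsRealValued h ∧ IsRealValued b ∧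
      distLpNorm (ENNReal.ofReal p) h ≤ distLpNorm (ENNReal.ofReal p) f ∧
      distLpNorm (ENNReal.ofReal p) b ≤ distLpNorm (ENNReal.ofReal p) f ∧
      distLpNorm 2 h ≤
        ENNReal.ofReal (l ^ (1 - p / 2)) * distLpNorm (ENNReal.ofReal p) f ^ (p / 2) ∧
      distLpNorm (ENNReal.ofReal (2 * p)) b ≤
        ENNReal.ofReal l ^ (1 / 2 : ℝ) * distLpNorm (ENNReal.ofReal p) f ^ (1 / 2 : ℝ) := by
  have hp1 : 1 ≤ ENNReal.ofReal p := one_le_ofReal_of_one_lt (by linarith)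
  obtain ⟨F, hF, hF', hFn⟩ := exists_eLpNorm_eq_distLpNorm hp1 hfp
  -- A strongly measurable representative makes the level set {|F₀| > l} measurable.
  obtain ⟨F₀, hF₀, hFF₀⟩ : AEStronglyMeasurable F volume := hF.1
  replace hF' : ∀ u : 𝓢(EuclideanSpace ℝ (Fin d), ℂ), f u = ∫ x, u x • F₀ x := fun u => by
    rw [hF']
    refine integral_congr_ae ?_
    filter_upwards [hFF₀] with x hx
    rw [hx]
  replace hF := (memLp_congr_ae hFF₀).1 hF
  rw [eLpNorm_congr_ae hFF₀] at hFn
  have hre := hf.ae_im_eq_zero hp1 hF hF'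
  have hs : MeasurableSet {x | l < ‖F₀ x‖} :=
    measurableSet_lt measurable_const hF₀.norm.measurable
  have hH := hF.indicator hs
  have hB := hF.indicator hs.compl
  obtain ⟨h, hh⟩ := exists_distribution_of_memLp hp1 hH
  obtain ⟨b, hb⟩ := exists_distribution_of_memLp hp1 hB
  have h2 := eLpNorm_indicator_two_le (μ := volume) (F := F₀) hp hl
  have hBl := eLpNorm_two_mul_le (μ := volume) (B := {x | l < ‖F₀ x‖}ᶜ.indicator F₀) (p := p)
    (by linarith) (Λ := ENNReal.ofReal l) ENNReal.ofReal_ne_top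
    (Filter.Eventually.of_forall fun x => by
      by_cases hx : l < ‖F₀ x‖
      · rw [Set.indicator_of_notMem (by simpa using hx)]; simp
      · rw [Set.indicator_of_mem (by simpa using hx), ← ofReal_norm]
        exact ENNReal.ofReal_le_ofReal (not_lt.1 hx))
  have hBl' := hBl.trans (mul_le_mul_right (ENNReal.rpow_le_rpow
    (eLpNorm_indicator_le F₀ (s := {x | l < ‖F₀ x‖}ᶜ)) (by norm_num : (0 : ℝ) ≤ 1 / 2)) _)
  rw [hFn] at h2 hBl'
  refine ⟨h, b, ?_, ?_, ?_, ?_, ?_, ?_, ?_⟩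
  · ext1 u
    change f u = h u + b u
    rw [hF', hh, hb, ← integral_add (integrable_schwartz_smul hp1 hH u)
      (integrable_schwartz_smul hp1 hB u)]
    simp only [← smul_add, Set.indicator_self_add_compl_apply]
  · refine isRealValued_of_ae_im_eq_zero hp1 hH hh ?_
    filter_upwards [hre] with x hx i
    by_cases hxs : x ∈ {x | l < ‖F₀ x‖}
    · rw [Set.indicator_of_mem hxs]; exact hx i
    · rw [Set.indicator_of_notMem hxs]; rfl
  · refine isRealValued_of_ae_im_eq_zero hp1 hB hb ?_
    filter_upwards [hre] with x hx i
    by_cases hxs : x ∈ {x | l < ‖F₀ x‖}ᶜ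
    · rw [Set.indicator_of_mem hxs]; exact hx i
    · rw [Set.indicator_of_notMem hxs]; rfl
  · exact (distLpNorm_le_eLpNorm hH hh).trans (hFn ▸ eLpNorm_indicator_le F₀)
  · exact (distLpNorm_le_eLpNorm hB hb).trans (hFn ▸ eLpNorm_indicator_le F₀)
  · refine (distLpNorm_le_eLpNorm ⟨hH.1, h2.trans_lt ?_⟩ hh).trans h2
    exact ENNReal.mul_lt_top ENNReal.ofReal_lt_top
      (ENNReal.rpow_lt_top_of_nonneg (by linarith) hfp.ne)
  · refine (distLpNorm_le_eLpNorm ⟨hB.1, hBl'.trans_lt ?_⟩ hb).trans hBl'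
    exact ENNReal.mul_lt_top
      (ENNReal.rpow_lt_top_of_nonneg (by norm_num) ENNReal.ofReal_ne_top)
      (ENNReal.rpow_lt_top_of_nonneg (by norm_num) hfp.ne)

end Truncation

/-! ### Sums of localized pieces -/

section Synthesis

variable {d : ℕ} {φ : EuclideanSpace ℝ (Fin d) → ℝ}

theorem IsLittlewoodPaley.lpProj_eq_sum_of_hasSum (hφ : IsLittlewoodPaley φ)
    {A : ℤ → VectorDistribution d} {f : VectorDistribution d}
    (h : HasSum (fun j => lerayProj φ j (A j)) f) (k : ℤ) :
    lpProj φ k f =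
      ∑ i ∈ Finset.Icc (-2 : ℤ) 2, lpProj φ k (lerayProj φ (k - i) (A (k - i))) := by
  have h1 := h.mapL (dyadicMul (fun ξ => (φ ξ : ℂ)) k)
  rw [← (Equiv.subLeft k).hasSum_iff] at h1
  refine h1.unique (hasSum_sum_of_ne_finset_zero fun i hi => ?_)
  have := hφ.lpProj_lerayProj_eq_zero hi (k - i) (A (k - i))
  rw [sub_add_cancel] at this
  exact this

/-- The A_j need no frequency localization of their own, since `lerayProj` supplies it; this is what
admits truncated blocks. -/
theorem IsLittlewoodPaley.exists_distLpNorm_lpProj_le_of_hasSum (hφ : IsLittlewoodPaley φ) :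
    ∃ C : ℝ≥0∞, C < ∞ ∧ ∀ (A : ℤ → VectorDistribution d) (f : VectorDistribution d)
      (_ : HasSum (fun j => lerayProj φ j (A j)) f) (r : ℝ) (_ : 1 < r) (k : ℤ),
      distLpNorm (ENNReal.ofReal r) (lpProj φ k f) ≤
        C * ∑ i ∈ Finset.Icc (-2 : ℤ) 2, distLpNorm (ENNReal.ofReal r) (A (k - i)) := by
  obtain ⟨C₁, hC₁, h₁⟩ := exists_distLpNorm_dyadicMul_le hφ.isAnnularSymbol
  obtain ⟨C₂, hC₂, h₂⟩ := hφ.exists_distLpNorm_lerayProj_le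
  refine ⟨C₁ * C₂, ENNReal.mul_lt_top hC₁ hC₂, fun A f hf r hr k => ?_⟩
  rw [hφ.lpProj_eq_sum_of_hasSum hf k, Finset.mul_sum]
  refine (distLpNorm_sum_le (one_le_ofReal_of_one_lt hr) _ _).trans
    (Finset.sum_le_sum fun i _ => ?_)
  rw [mul_assoc]
  exact (h₁ k r hr _).trans (by gcongr; exact h₂ _ r hr _)

/-- The Littlewood–Paley decomposition of an absolutely convergent sum of localized pieces
converges. -/
theorem IsLittlewoodPaley.hasSum_lpProj_of_hasSum (hφ : IsLittlewoodPaley φ)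
    {A : ℤ → VectorDistribution d} {f : VectorDistribution d}
    (h : HasSum (fun j => lerayProj φ j (A j)) f)
    (hA : ∑' j, distLpNorm 2 (lerayProj φ j (A j)) < ∞) :
    HasSum (fun k => lpProj φ k f) f := by
  obtain ⟨C₁, hC₁, h₁⟩ := exists_distLpNorm_dyadicMul_le hφ.isAnnularSymbol
  have h2 : ENNReal.ofReal 2 = 2 := by simp
  -- The family Δ_{j+i} P_j A_j is summed in two ways. Grouped by j over the five offsets i it gives
  -- f; reindexed by k = j + i it gives the series of Δ_k f. Convergence for each offset comes from
  -- L^2.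
  have hS : ∀ i : ℤ, ∃ g, HasSum (fun j => lpProj φ (j + i) (lerayProj φ j (A j))) g := by
    intro i
    have hlt : ∑' j, distLpNorm 2 (lpProj φ (j + i) (lerayProj φ j (A j))) < ∞ := by
      refine lt_of_le_of_lt (ENNReal.tsum_le_tsum fun j => ?_)
        (ENNReal.tsum_mul_left.trans_lt (ENNReal.mul_lt_top hC₁ hA))
      rw [← h2]
      exact h₁ (j + i) 2 one_lt_two _
    obtain ⟨g, hg, -⟩ := exists_hasSum_of_tsum_distLpNorm_lt_top one_le_two hlt
    exact ⟨g, hg⟩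
  choose S hS using hS
  have hsum := hasSum_sum (s := Finset.Icc (-2 : ℤ) 2) fun i _ => hS i
  simp only [hφ.sum_lpProj_lerayProj] at hsum
  have hSf : ∑ i ∈ Finset.Icc (-2 : ℤ) 2, S i = f := hsum.unique h
  have hre : ∀ i : ℤ, HasSum (fun k => lpProj φ k (lerayProj φ (k - i) (A (k - i)))) (S i) := by
    intro i
    have := (Equiv.subRight i).hasSum_iff.2 (hS i)
    simpa [Function.comp_def] using this
  have hsum' := hasSum_sum (s := Finset.Icc (-2 : ℤ) 2) fun i _ => hre i
  rw [hSf] at hsum'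
  simpa only [← hφ.lpProj_eq_sum_of_hasSum h] using hsum'

theorem IsLittlewoodPaley.hasSum_lerayProj_lpProj (hφ : IsLittlewoodPaley φ)
    {g : VectorDistribution d} (hg : IsDivFree g) (h : HasSum (fun j => lpProj φ j g) g) :
    HasSum (fun j => lerayProj φ j (lpProj φ j g)) g := by
  simpa only [hφ.lerayProj_lpProj _ hg] using h

end Synthesis

/-! ### Sequence norms and geometric weights -/

section SequenceNorms

theorem tsum_sum_sub (v : ℤ → ℝ≥0∞) (s : Finset ℤ) :
    ∑' k, ∑ i ∈ s, v (k - i) = s.card * ∑' k, v k := by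
  rw [Summable.tsum_finsetSum fun _ _ => ENNReal.summable]
  have : ∀ i : ℤ, ∑' k, v (k - i) = ∑' k, v k := fun i => (Equiv.subRight i).tsum_eq v
  simp [this]

/-- The embedding ℓ^1 ⊂ ℓ^q loses nothing essential here, as the sequences to be summed decay
geometrically away from J. -/
theorem seqNorm_le_tsum {q : ℝ} (hq : 1 ≤ q) (a : ℤ → ℝ≥0∞) :
    seqNorm (ENNReal.ofReal q) a ≤ ∑' k, a k := by
  have hq0 : 0 < q := by linarith
  rw [seqNorm, if_neg ENNReal.ofReal_ne_top, ENNReal.toReal_ofReal hq0.le]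
  have h1 : ∑' k, a k ^ q ≤ (∑' k, a k) ^ q := by
    calc ∑' k, a k ^ q = ∑' k, a k * a k ^ (q - 1) := by
          refine tsum_congr fun k => ?_
          conv_lhs => rw [show q = 1 + (q - 1) by ring,
            ENNReal.rpow_add_of_nonneg _ _ zero_le_one (by linarith), ENNReal.rpow_one]
      _ ≤ ∑' k, a k * (∑' k, a k) ^ (q - 1) := by
          refine ENNReal.tsum_le_tsum fun k => ?_
          exact mul_le_mul_right (ENNReal.rpow_le_rpow (ENNReal.le_tsum k) (by linarith)) _
      _ = (∑' k, a k) * (∑' k, a k) ^ (q - 1) := ENNReal.tsum_mul_right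
      _ = (∑' k, a k) ^ q := by
          conv_rhs => rw [show q = 1 + (q - 1) by ring,
            ENNReal.rpow_add_of_nonneg _ _ zero_le_one (by linarith), ENNReal.rpow_one]
  calc (∑' k, a k ^ q) ^ (1 / q) ≤ ((∑' k, a k) ^ q) ^ (1 / q) := by gcongr
    _ = ∑' k, a k := by
        rw [← ENNReal.rpow_mul, mul_one_div_cancel hq0.ne', ENNReal.rpow_one]

theorem tsum_two_rpow_neg_abs_lt_top {α : ℝ} (hα : 0 < α) :
    ∑' j : ℤ, ENNReal.ofReal ((2 : ℝ) ^ (-(α * |(j : ℝ)|))) < ∞ := by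
  have hs : Summable fun j : ℤ => (2 : ℝ) ^ (-(α * |(j : ℝ)|)) := by
    have hr : Summable fun n : ℕ => (2 : ℝ) ^ (-(α * (n : ℝ))) := by
      have : ∀ n : ℕ, (2 : ℝ) ^ (-(α * (n : ℝ))) = ((2 : ℝ) ^ (-α)) ^ n := fun n => by
        rw [← Real.rpow_natCast, ← Real.rpow_mul zero_le_two]
        congr 1
        ring
      simp only [this]
      exact summable_geometric_of_lt_one (by positivity)
        (Real.rpow_lt_one_of_one_lt_of_neg one_lt_two (by linarith))
    refine Summable.of_nat_of_neg ?_ ?_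
    · simpa using hr
    · simpa using hr
  rw [← ENNReal.ofReal_tsum_of_nonneg (fun j => by positivity) hs]
  exact ENNReal.ofReal_lt_top

theorem tsum_two_rpow_neg_abs_sub (α : ℝ) (J : ℤ) :
    ∑' j : ℤ, ENNReal.ofReal ((2 : ℝ) ^ (-(α * |(j : ℝ) - J|))) =
      ∑' j : ℤ, ENNReal.ofReal ((2 : ℝ) ^ (-(α * |(j : ℝ)|))) := by
  rw [← (Equiv.subRight J).tsum_eq fun j : ℤ => ENNReal.ofReal ((2 : ℝ) ^ (-(α * |(j : ℝ)|)))]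
  simp

theorem two_rpow_mul_le {σ : ℝ} (h1 : -1 ≤ σ) (h2 : σ ≤ 1) {i : ℤ}
    (hi : i ∈ Finset.Icc (-2 : ℤ) 2) (k : ℤ) :
    (2 : ℝ) ^ ((k : ℝ) * σ) ≤ 4 * (2 : ℝ) ^ (((k - i : ℤ) : ℝ) * σ) := by
  rw [Finset.mem_Icc] at hi
  have h4 : (4 : ℝ) = (2 : ℝ) ^ (2 : ℝ) := by norm_num
  rw [h4, ← Real.rpow_add two_pos]
  refine Real.rpow_le_rpow_of_exponent_le one_le_two ?_
  push_cast
  have hi1 : (-2 : ℝ) ≤ i := by exact_mod_cast hi.1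
  have hi2 : (i : ℝ) ≤ 2 := by exact_mod_cast hi.2
  nlinarith

end SequenceNorms

/-! ### Besov norms of synthesized sums -/

section BesovBounds

variable {d : ℕ} {φ : EuclideanSpace ℝ (Fin d) → ℝ}

theorem IsLittlewoodPaley.exists_weighted_distLpNorm_lpProj_le (hφ : IsLittlewoodPaley φ) :
    ∃ C : ℝ≥0∞, C < ∞ ∧ ∀ (A : ℤ → VectorDistribution d) (f : VectorDistribution d)
      (_ : HasSum (fun j => lerayProj φ j (A j)) f) (r : ℝ) (_ : 1 < r) (σ : ℝ) (_ : -1 ≤ σ)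
      (_ : σ ≤ 1) (k : ℤ),
      ENNReal.ofReal ((2 : ℝ) ^ ((k : ℝ) * σ)) * distLpNorm (ENNReal.ofReal r) (lpProj φ k f) ≤
        C * ∑ i ∈ Finset.Icc (-2 : ℤ) 2, ENNReal.ofReal ((2 : ℝ) ^ (((k - i : ℤ) : ℝ) * σ)) *
          distLpNorm (ENNReal.ofReal r) (A (k - i)) := by
  obtain ⟨C, hC, h⟩ := hφ.exists_distLpNorm_lpProj_le_of_hasSum
  refine ⟨C * 4, ENNReal.mul_lt_top hC (by simp), fun A f hf r hr σ h1 h2 k => ?_⟩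
  calc _ ≤ ENNReal.ofReal ((2 : ℝ) ^ ((k : ℝ) * σ)) *
        (C * ∑ i ∈ Finset.Icc (-2 : ℤ) 2, distLpNorm (ENNReal.ofReal r) (A (k - i))) := by
        gcongr
        exact h A f hf r hr k
    _ = C * ∑ i ∈ Finset.Icc (-2 : ℤ) 2, ENNReal.ofReal ((2 : ℝ) ^ ((k : ℝ) * σ)) *
          distLpNorm (ENNReal.ofReal r) (A (k - i)) := by
        rw [mul_left_comm, Finset.mul_sum]
    _ ≤ C * ∑ i ∈ Finset.Icc (-2 : ℤ) 2,
          4 * (ENNReal.ofReal ((2 : ℝ) ^ (((k - i : ℤ) : ℝ) * σ)) *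
          distLpNorm (ENNReal.ofReal r) (A (k - i))) := by
        refine mul_le_mul_right (Finset.sum_le_sum fun i hi => ?_) _
        rw [← mul_assoc]
        refine mul_le_mul_left ?_ _
        refine (ENNReal.ofReal_le_ofReal (two_rpow_mul_le h1 h2 hi k)).trans_eq ?_
        rw [ENNReal.ofReal_mul (by norm_num), ENNReal.ofReal_ofNat]
    _ = _ := by rw [← Finset.mul_sum, mul_assoc]

/-- The supremum form serves the critical norms, the ℓ^1 form the L^{2p} estimate of the regular
part. The overlap of five blocks costs a factor 5. -/
theorem IsLittlewoodPaley.exists_besovNorm_le (hφ : IsLittlewoodPaley φ) :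
    ∃ C : ℝ≥0∞, C < ∞ ∧ ∀ (A : ℤ → VectorDistribution d) (f : VectorDistribution d)
      (_ : HasSum (fun j => lerayProj φ j (A j)) f) (r : ℝ) (_ : 1 < r) (σ : ℝ) (_ : -1 ≤ σ)
      (_ : σ ≤ 1),
      besovNorm φ σ (ENNReal.ofReal r) ∞ f ≤
        C * ⨆ j : ℤ, ENNReal.ofReal ((2 : ℝ) ^ ((j : ℝ) * σ)) *
          distLpNorm (ENNReal.ofReal r) (A j) ∧
      ∀ q : ℝ, 1 ≤ q → besovNorm φ σ (ENNReal.ofReal r) (ENNReal.ofReal q) f ≤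
        C * ∑' j : ℤ, ENNReal.ofReal ((2 : ℝ) ^ ((j : ℝ) * σ)) *
          distLpNorm (ENNReal.ofReal r) (A j) := by
  obtain ⟨C, hC, h⟩ := hφ.exists_weighted_distLpNorm_lpProj_le
  refine ⟨C * 5, ENNReal.mul_lt_top hC (by simp), fun A f hf r hr σ h1 h2 => ⟨?_, fun q hq => ?_⟩⟩
  · rw [besovNorm, seqNorm, if_pos rfl]
    refine iSup_le fun k => (h A f hf r hr σ h1 h2 k).trans ?_
    rw [mul_assoc]
    gcongr
    refine (Finset.sum_le_card_nsmul _ _ _ fun i _ => le_iSup (fun j : ℤ =>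
      ENNReal.ofReal ((2 : ℝ) ^ ((j : ℝ) * σ)) * distLpNorm (ENNReal.ofReal r) (A j))
        (k - i)).trans_eq ?_
    simp
  · refine (seqNorm_le_tsum hq _).trans ?_
    refine (ENNReal.tsum_le_tsum fun k => h A f hf r hr σ h1 h2 k).trans_eq ?_
    rw [ENNReal.tsum_mul_left, tsum_sum_sub (fun j => ENNReal.ofReal ((2 : ℝ) ^ ((j : ℝ) * σ)) *
      distLpNorm (ENNReal.ofReal r) (A j)), mul_assoc]
    simp

end BesovBounds

/-! ### Splitting the blocks and summing up -/

section Splitting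

variable {d : ℕ} {φ : EuclideanSpace ℝ (Fin d) → ℝ}

/-- Since s + t = 1 the result is linear in m, hence the final bounds are linear in the norm of g.
-/
theorem rpow_two_mul_eq {m : ℝ} (hm : 0 < m) (a b s t : ℝ) (hst : s + t = 1) :
    (2 ^ a * m) ^ s * (2 ^ b * m) ^ t = (2 : ℝ) ^ (a * s + b * t) * m := by
  rw [Real.mul_rpow (by positivity) hm.le, Real.mul_rpow (by positivity) hm.le,
    ← Real.rpow_mul zero_le_two, ← Real.rpow_mul zero_le_two, Real.rpow_add two_pos]
  have : m ^ s * m ^ t = m := by rw [← Real.rpow_add hm, hst, Real.rpow_one]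
  linear_combination (2 : ℝ) ^ (a * s) * 2 ^ (b * t) * this

/-- Splitting of a dyadic block: below the frequency `2 ^ J` nothing is moved into `L^2`, above it
the block is truncated at the height `2 ^ (J / (2 p) + (1 - 1 / (2 p)) j) m`. -/
theorem exists_split_dyadic_block (hd : 3 ≤ d) {p : ℝ} (hp : (d : ℝ) < p)
    {f : VectorDistribution d} (hf : IsRealValued f) {C : ℝ≥0∞} (hC : C < ∞) (hC1 : 1 ≤ C)
    {m : ℝ} (hm : 0 ≤ m) (j J : ℤ)
    (hX : distLpNorm (ENNReal.ofReal p) f ≤ ENNReal.ofReal (2 ^ (-((j : ℝ) * critReg d p)) * m))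
    (hB : distLpNorm ∞ f ≤
      C * ENNReal.ofReal (2 ^ ((j : ℝ) * (d / p))) * distLpNorm (ENNReal.ofReal p) f) :
    ∃ h b : VectorDistribution d, f = h + b ∧ IsRealValued h ∧ IsRealValued b ∧
      distLpNorm (ENNReal.ofReal p) h ≤ distLpNorm (ENNReal.ofReal p) f ∧
      distLpNorm (ENNReal.ofReal p) b ≤ distLpNorm (ENNReal.ofReal p) f ∧
      distLpNorm 2 h ≤ ENNReal.ofReal (2 ^ (-((d / 2 - 1) * (J : ℝ)) -
        1 / 4 * |(j : ℝ) - J|) * m) ∧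
      ENNReal.ofReal (2 ^ ((j : ℝ) * (critReg d (2 * p) + 1 / (8 * p)))) *
        distLpNorm (ENNReal.ofReal (2 * p)) b ≤
        C * ENNReal.ofReal (2 ^ (1 / (8 * p) * (J : ℝ) - 1 / (8 * p) * |(j : ℝ) - J|) * m) := by
  have hd3 : (3 : ℝ) ≤ d := by exact_mod_cast hd
  have hp0 : 0 < p := by linarith
  have hXt : distLpNorm (ENNReal.ofReal p) f < ∞ := hX.trans_lt ENNReal.ofReal_lt_top
  -- The case m = 0 joins the low frequencies, since a truncation height must be positive.
  by_cases hcase : J ≤ j ∧ 0 < m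
  · obtain ⟨hjJ, hm0⟩ := hcase
    have hjJ' : (0 : ℝ) ≤ (j : ℝ) - J := by
      have : (J : ℝ) ≤ j := by exact_mod_cast hjJ
      linarith
    rw [abs_of_nonneg hjJ']
    set a : ℝ := 1 / (2 * p) * J + (1 - 1 / (2 * p)) * j with ha
    have hl : 0 < (2 : ℝ) ^ a * m := by positivity
    obtain ⟨h, b, hfb, hhr, hbr, hhp, hbp, hh2, hb2⟩ :=
      exists_truncation hf (by linarith : 2 < p) hXt hl
    refine ⟨h, b, hfb, hhr, hbr, hhp, hbp, ?_, ?_⟩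
    · refine hh2.trans ?_
      calc _ ≤ ENNReal.ofReal ((2 ^ a * m) ^ (1 - p / 2)) *
            ENNReal.ofReal (2 ^ (-((j : ℝ) * critReg d p)) * m) ^ (p / 2) := by gcongr
        _ = ENNReal.ofReal ((2 ^ a * m) ^ (1 - p / 2) *
            (2 ^ (-((j : ℝ) * critReg d p)) * m) ^ (p / 2)) := by
            rw [ENNReal.ofReal_rpow_of_nonneg (by positivity) (by positivity),
              ← ENNReal.ofReal_mul (by positivity)]
        _ ≤ _ := by
            rw [rpow_two_mul_eq hm0 _ _ _ _ (by ring)]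
            refine ENNReal.ofReal_le_ofReal ?_
            gcongr
            · norm_num
            -- As d ≥ 3, the coefficient of j - J is at most -1/4 even after -1/(2p) is dropped.
            have hexp : a * (1 - p / 2) + -((j : ℝ) * critReg d p) * (p / 2) =
                -((d / 2 - 1) * (J : ℝ)) + (1 - d / 2 + 1 / 4 - 1 / (2 * p)) * ((j : ℝ) - J) := by
              rw [ha, critReg]
              field_simp
              ring
            rw [hexp]
            have : 0 < 1 / (2 * p) := by positivity
            nlinarith
    · calc _ ≤ ENNReal.ofReal (2 ^ ((j : ℝ) * (critReg d (2 * p) + 1 / (8 * p)))) *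
            (ENNReal.ofReal (2 ^ a * m) ^ (1 / 2 : ℝ) *
            ENNReal.ofReal (2 ^ (-((j : ℝ) * critReg d p)) * m) ^ (1 / 2 : ℝ)) := by
            gcongr
            refine hb2.trans ?_
            gcongr
        _ = ENNReal.ofReal (2 ^ ((j : ℝ) * (critReg d (2 * p) + 1 / (8 * p))) *
            ((2 ^ a * m) ^ (1 / 2 : ℝ) *
              (2 ^ (-((j : ℝ) * critReg d p)) * m) ^ (1 / 2 : ℝ))) := by
            rw [ENNReal.ofReal_rpow_of_nonneg (by positivity) (by positivity),
              ENNReal.ofReal_rpow_of_nonneg (by positivity) (by positivity),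
              ← ENNReal.ofReal_mul (by positivity), ← ENNReal.ofReal_mul (by positivity)]
        _ = 1 * ENNReal.ofReal
              (2 ^ (1 / (8 * p) * (J : ℝ) - 1 / (8 * p) * ((j : ℝ) - J)) * m) := by
            rw [rpow_two_mul_eq hm0 _ _ _ _ (by norm_num), ← mul_assoc, ← Real.rpow_add two_pos,
              one_mul]
            congr 3
            rw [ha, critReg, critReg]
            field_simp
            ring
        _ ≤ _ := by gcongr
  · refine ⟨0, f, (zero_add f).symm, fun u hu i => rfl, hf, ?_, le_rfl, ?_, ?_⟩
    · rw [distLpNorm_zero]; exact bot_le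
    · rw [distLpNorm_zero]; exact bot_le
    set X := distLpNorm (ENNReal.ofReal p) f with hXdef
    have hBt : distLpNorm ∞ f < ∞ := hB.trans_lt
      (ENNReal.mul_lt_top (ENNReal.mul_lt_top hC ENNReal.ofReal_lt_top) hXt)
    have hC2 : C ^ (1 / 2 : ℝ) ≤ C := by
      conv_rhs => rw [← ENNReal.rpow_one C]
      exact ENNReal.rpow_le_rpow_of_exponent_le hC1 (by norm_num)
    have hXX : X ^ (1 / 2 : ℝ) * X ^ (1 / 2 : ℝ) = X := by
      rw [← ENNReal.rpow_add_of_nonneg _ _ (by norm_num) (by norm_num)]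
      norm_num
    -- Interpolation halves the Bernstein exponent d/p, and C ≥ 1 absorbs its square root.
    have h1 : distLpNorm (ENNReal.ofReal (2 * p)) f ≤
        C * ENNReal.ofReal (2 ^ ((j : ℝ) * (d / (2 * p)))) * X := by
      refine (distLpNorm_two_mul_le (by linarith) hXt hBt).trans ?_
      calc distLpNorm ∞ f ^ (1 / 2 : ℝ) * X ^ (1 / 2 : ℝ)
          ≤ (C * ENNReal.ofReal (2 ^ ((j : ℝ) * (d / p))) * X) ^ (1 / 2 : ℝ) *
            X ^ (1 / 2 : ℝ) := by gcongr
        _ = C ^ (1 / 2 : ℝ) * ENNReal.ofReal (2 ^ ((j : ℝ) * (d / (2 * p)))) * X := by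
            rw [ENNReal.mul_rpow_of_nonneg _ _ (by norm_num),
              ENNReal.mul_rpow_of_nonneg _ _ (by norm_num), mul_assoc, hXX,
              ENNReal.ofReal_rpow_of_nonneg (by positivity) (by norm_num),
              ← Real.rpow_mul zero_le_two]
            congr 4
            field_simp
        _ ≤ _ := by gcongr
    calc _ ≤ ENNReal.ofReal (2 ^ ((j : ℝ) * (critReg d (2 * p) + 1 / (8 * p)))) *
          (C * ENNReal.ofReal (2 ^ ((j : ℝ) * (d / (2 * p)))) *
            ENNReal.ofReal (2 ^ (-((j : ℝ) * critReg d p)) * m)) := by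
          gcongr
          refine h1.trans ?_
          gcongr
      _ = C * ENNReal.ofReal (2 ^ ((j : ℝ) * (critReg d (2 * p) + 1 / (8 * p))) *
          (2 ^ ((j : ℝ) * (d / (2 * p))) * (2 ^ (-((j : ℝ) * critReg d p)) * m))) := by
          rw [ENNReal.ofReal_mul (by positivity), ENNReal.ofReal_mul (by positivity),
            ENNReal.ofReal_mul (by positivity), ENNReal.ofReal_mul (by positivity)]
          ring
      _ ≤ _ := by
          refine mul_le_mul_right (ENNReal.ofReal_le_ofReal ?_) _
          rcases hm.eq_or_lt with h0 | h0
          · rw [← h0]; simp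
          have hjJ : j < J := by
            by_contra hcon
            exact hcase ⟨not_lt.1 hcon, h0⟩
          have hjJ' : (j : ℝ) - J < 0 := by
            have : (j : ℝ) < J := by exact_mod_cast hjJ
            linarith
          rw [abs_of_neg hjJ', ← mul_assoc, ← mul_assoc, ← Real.rpow_add two_pos,
            ← Real.rpow_add two_pos]
          refine le_of_eq ?_
          congr 2
          rw [critReg, critReg]
          field_simp
          ring

/-- The decomposition at the dyadic frequency `2 ^ J`. -/
theorem IsLittlewoodPaley.exists_decomposition (hφ : IsLittlewoodPaley φ) (hd : 3 ≤ d) {p : ℝ}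
    (hp : (d : ℝ) < p) :
    ∃ K : ℝ≥0∞, K < ∞ ∧ ∀ g : VectorDistribution d, IsRealValued g → IsDivFree g →
      MemBesov φ (critReg d p) (ENNReal.ofReal p) ∞ g → ∀ J : ℤ,
      ∃ gt gb : VectorDistribution d,
        IsRealValued gt ∧ IsRealValued gb ∧ IsDivFree gt ∧ IsDivFree gb ∧ g = gt + gb ∧
        HasSum (fun j : ℤ => lpProj φ j gt) gt ∧ HasSum (fun j : ℤ => lpProj φ j gb) gb ∧
        distLpNorm 2 gt ≤ K * ENNReal.ofReal (2 ^ (-((d / 2 - 1) * (J : ℝ)))) *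
          besovNorm φ (critReg d p) (ENNReal.ofReal p) ∞ g ∧
        besovNorm φ (critReg d (2 * p) + 1 / (8 * p)) (ENNReal.ofReal (2 * p))
            (ENNReal.ofReal (2 * p)) gb ≤
          K * ENNReal.ofReal (2 ^ (1 / (8 * p) * (J : ℝ))) *
          besovNorm φ (critReg d p) (ENNReal.ofReal p) ∞ g ∧
        besovNorm φ (critReg d p) (ENNReal.ofReal p) ∞ gt ≤
          K * besovNorm φ (critReg d p) (ENNReal.ofReal p) ∞ g ∧
        besovNorm φ (critReg d p) (ENNReal.ofReal p) ∞ gb ≤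
          K * besovNorm φ (critReg d p) (ENNReal.ofReal p) ∞ g := by
  have hd3 : (3 : ℝ) ≤ d := by exact_mod_cast hd
  have hp0 : 0 < p := by linarith
  obtain ⟨Cb, hCb, hbern⟩ := exists_distLpNorm_top_dyadicMul_le hφ.isAnnularSymbol_fatten
    (by linarith : 1 < p)
  obtain ⟨Ct, hCt, hler⟩ := hφ.exists_distLpNorm_lerayProj_le
  obtain ⟨Cs, hCs, hbes⟩ := hφ.exists_besovNorm_le
  have hG₁ := tsum_two_rpow_neg_abs_lt_top (by norm_num : (0 : ℝ) < 1 / 4)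
  have hG₂ := tsum_two_rpow_neg_abs_lt_top (by positivity : (0 : ℝ) < 1 / (8 * p))
  set G₁ := ∑' j : ℤ, ENNReal.ofReal ((2 : ℝ) ^ (-(1 / 4 * |(j : ℝ)|))) with hG₁def
  set G₂ := ∑' j : ℤ, ENNReal.ofReal ((2 : ℝ) ^ (-(1 / (8 * p) * |(j : ℝ)|))) with hG₂def
  have hdp : (d : ℝ) / p < 1 := (div_lt_one hp0).2 hp
  have hdp0 : 0 < (d : ℝ) / p := by positivity
  have hdp2 : (d : ℝ) / (2 * p) < 1 / 2 := by
    rw [div_lt_div_iff₀ (by positivity) two_pos]; linarith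
  have hdp20 : 0 < (d : ℝ) / (2 * p) := by positivity
  have h8p : 1 / (8 * p) < 1 / 8 := by
    rw [div_lt_div_iff₀ (by positivity) (by norm_num)]; linarith
  have h8p0 : 0 < 1 / (8 * p) := by positivity
  have hs1 : -1 ≤ critReg d p := by rw [critReg]; linarith
  have hs2 : critReg d p ≤ 1 := by rw [critReg]; linarith
  have hσ1 : -1 ≤ critReg d (2 * p) + 1 / (8 * p) := by rw [critReg]; linarith
  have hσ2 : critReg d (2 * p) + 1 / (8 * p) ≤ 1 := by rw [critReg]; linarith
  refine ⟨Ct * G₁ + Cs * (Cb + 1) * G₂ + Cs, ?_, fun g hgr hgd hgB J => ?_⟩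
  · refine ENNReal.add_lt_top.2 ⟨ENNReal.add_lt_top.2 ⟨ENNReal.mul_lt_top hCt hG₁,
      ENNReal.mul_lt_top (ENNReal.mul_lt_top hCs (ENNReal.add_lt_top.2 ⟨hCb, by simp⟩)) hG₂⟩, hCs⟩
  obtain ⟨hM, hgsum⟩ := hgB
  set M := besovNorm φ (critReg d p) (ENNReal.ofReal p) ∞ g with hMdef
  set K := Ct * G₁ + Cs * (Cb + 1) * G₂ + Cs with hK
  have hMm : ENNReal.ofReal M.toReal = M := ENNReal.ofReal_toReal hM.ne
  have hblock : ∀ j : ℤ, ENNReal.ofReal (2 ^ ((j : ℝ) * critReg d p)) *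
      distLpNorm (ENNReal.ofReal p) (lpProj φ j g) ≤ M := fun j => by
    rw [hMdef, besovNorm, seqNorm, if_pos rfl]
    exact le_iSup (fun j : ℤ => ENNReal.ofReal (2 ^ ((j : ℝ) * critReg d p)) *
      distLpNorm (ENNReal.ofReal p) (lpProj φ j g)) j
  have hX : ∀ j : ℤ, distLpNorm (ENNReal.ofReal p) (lpProj φ j g) ≤
      ENNReal.ofReal (2 ^ (-((j : ℝ) * critReg d p)) * M.toReal) := fun j => by
    rw [ENNReal.ofReal_mul (by positivity), hMm]
    calc _ = ENNReal.ofReal (2 ^ (-((j : ℝ) * critReg d p))) *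
          (ENNReal.ofReal (2 ^ ((j : ℝ) * critReg d p)) *
            distLpNorm (ENNReal.ofReal p) (lpProj φ j g)) := by
          rw [← mul_assoc, ← ENNReal.ofReal_mul (by positivity), ← Real.rpow_add two_pos]
          simp
      _ ≤ _ := by gcongr; exact hblock j
  have hB : ∀ j : ℤ, distLpNorm ∞ (lpProj φ j g) ≤
      (Cb + 1) * ENNReal.ofReal (2 ^ ((j : ℝ) * (d / p))) *
        distLpNorm (ENNReal.ofReal p) (lpProj φ j g) := fun j => by
    have := hbern j (lpProj φ j g) ((hX j).trans_lt ENNReal.ofReal_lt_top)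
    rw [hφ.dyadicMul_fatten_lpProj] at this
    exact this.trans (by gcongr; exact le_self_add)
  choose h b hfb hhr hbr hhp hbp hh2 hb2 using fun j : ℤ =>
    exists_split_dyadic_block hd hp (hgr.lpProj hφ j) (ENNReal.add_lt_top.2 ⟨hCb, by simp⟩)
      le_add_self ENNReal.toReal_nonneg j J (hX j) (hB j)
  have h22 : ENNReal.ofReal 2 = 2 := by simp
  have hsum2 : ∑' j, distLpNorm 2 (lerayProj φ j (h j)) ≤
      Ct * G₁ * ENNReal.ofReal (2 ^ (-((d / 2 - 1) * (J : ℝ)))) * M := by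
    calc _ ≤ ∑' j : ℤ, Ct * ENNReal.ofReal (2 ^ (-((d / 2 - 1) * (J : ℝ)))) * M *
          ENNReal.ofReal ((2 : ℝ) ^ (-(1 / 4 * |(j : ℝ) - J|))) := by
          refine ENNReal.tsum_le_tsum fun j => ?_
          have h1 := hler j 2 one_lt_two (h j)
          rw [h22] at h1
          refine h1.trans ?_
          refine (mul_le_mul_right (hh2 j) _).trans_eq ?_
          rw [ENNReal.ofReal_mul (by positivity), hMm, sub_eq_add_neg, Real.rpow_add two_pos,
            ENNReal.ofReal_mul (by positivity)]
          ring
      _ = _ := by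
          rw [ENNReal.tsum_mul_left, tsum_two_rpow_neg_abs_sub]
          ring
  have hsum2t : ∑' j, distLpNorm 2 (lerayProj φ j (h j)) < ∞ :=
    hsum2.trans_lt (ENNReal.mul_lt_top (ENNReal.mul_lt_top (ENNReal.mul_lt_top hCt hG₁)
      ENNReal.ofReal_lt_top) hM)
  obtain ⟨gt, hgt, hgt2⟩ := exists_hasSum_of_tsum_distLpNorm_lt_top one_le_two hsum2t
  -- Convergence of the regular series is not proved directly: it is the difference of the series of
  -- g = ∑ P_j Δ_j g and the L^2 series.
  have hgb : HasSum (fun j => lerayProj φ j (b j)) (g - gt) := by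
    have := (hφ.hasSum_lerayProj_lpProj hgd hgsum).sub hgt
    refine this.congr_fun fun j => ?_
    rw [hfb j, lerayProj_add, add_sub_cancel_left]
  have hgtB := hφ.hasSum_lpProj_of_hasSum hgt hsum2t
  have hgtr := IsRealValued.of_hasSum hgt fun j => (hhr j).lerayProj hφ j
  have hgtd := IsDivFree.of_hasSum hgt fun j => hφ.isDivFree_lerayProj j (h j)
  refine ⟨gt, g - gt, hgtr, hgr.sub hgtr, hgtd, hgd.sub hgtd, by abel, hgtB, ?_, ?_, ?_, ?_, ?_⟩
  · have := hgsum.sub hgtB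
    simpa only [lpProj_eq_dyadicMul, map_sub] using this
  · refine (hgt2.trans hsum2).trans ?_
    gcongr
    exact le_self_add.trans le_self_add
  · refine ((hbes b _ hgb (2 * p) (by linarith) _ hσ1 hσ2).2 (2 * p) (by linarith)).trans ?_
    calc _ ≤ Cs * ∑' j : ℤ, (Cb + 1) * ENNReal.ofReal (2 ^ (1 / (8 * p) * (J : ℝ))) * M *
          ENNReal.ofReal ((2 : ℝ) ^ (-(1 / (8 * p) * |(j : ℝ) - J|))) := by
          refine mul_le_mul_right (ENNReal.tsum_le_tsum fun j => (hb2 j).trans_eq ?_) _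
          rw [ENNReal.ofReal_mul (by positivity), hMm, sub_eq_add_neg, Real.rpow_add two_pos,
            ENNReal.ofReal_mul (by positivity)]
          ring
      _ = Cs * (Cb + 1) * G₂ * ENNReal.ofReal (2 ^ (1 / (8 * p) * (J : ℝ))) * M := by
          rw [ENNReal.tsum_mul_left, tsum_two_rpow_neg_abs_sub]
          ring
      _ ≤ _ := by
          gcongr
          exact le_add_self.trans le_self_add
  · refine ((hbes h _ hgt p (by linarith) _ hs1 hs2).1).trans ?_
    refine mul_le_mul' le_add_self (iSup_le fun j => ?_)
    exact (mul_le_mul_right (hhp j) _).trans (hblock j)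
  · refine ((hbes b _ hgb p (by linarith) _ hs1 hs2).1).trans ?_
    refine mul_le_mul' le_add_self (iSup_le fun j => ?_)
    exact (mul_le_mul_right (hbp j) _).trans (hblock j)

end Splitting

/-! ### From dyadic thresholds to arbitrary N -/

theorem lemma1p5 (d : ℕ) (hd : 3 ≤ d) (p : ℝ) (hp : (d : ℝ) < p) :
    ∃ p₂ δ₂ γ₁ γ₂ : ℝ, p < p₂ ∧ 0 < δ₂ ∧ δ₂ < -critReg d p₂ ∧ 0 < γ₁ ∧ 0 < γ₂ ∧
      ∀ φ : EuclideanSpace ℝ (Fin d) → ℝ, IsLittlewoodPaley φ →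
      ∃ C : ℝ, 0 < C ∧
      ∀ g : VectorDistribution d, IsRealValued g → IsDivFree g →
        MemBesov φ (critReg d p) (ENNReal.ofReal p) ∞ g →
      ∀ N : ℝ, 0 < N →
      ∃ gt gb : VectorDistribution d,
        IsRealValued gt ∧ IsRealValued gb ∧ IsDivFree gt ∧ IsDivFree gb ∧
        distLpNorm 2 gt < ∞ ∧
        MemBesov φ (critReg d p) (ENNReal.ofReal p) ∞ gt ∧
        MemBesov φ (critReg d p₂ + δ₂) (ENNReal.ofReal p₂) (ENNReal.ofReal p₂) gb ∧
        MemBesov φ (critReg d p) (ENNReal.ofReal p) ∞ gb ∧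
        g = gt + gb ∧
        distLpNorm 2 gt ≤
          ENNReal.ofReal (C * N ^ (-γ₂)) * besovNorm φ (critReg d p) (ENNReal.ofReal p) ∞ g ∧
        besovNorm φ (critReg d p₂ + δ₂) (ENNReal.ofReal p₂) (ENNReal.ofReal p₂) gb ≤
          ENNReal.ofReal (C * N ^ γ₁) * besovNorm φ (critReg d p) (ENNReal.ofReal p) ∞ g ∧
        besovNorm φ (critReg d p) (ENNReal.ofReal p) ∞ gt ≤
          ENNReal.ofReal C * besovNorm φ (critReg d p) (ENNReal.ofReal p) ∞ g ∧
        besovNorm φ (critReg d p) (ENNReal.ofReal p) ∞ gb ≤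
          ENNReal.ofReal C * besovNorm φ (critReg d p) (ENNReal.ofReal p) ∞ g := by
  have hd3 : (3 : ℝ) ≤ d := by exact_mod_cast hd
  have hp0 : 0 < p := by linarith
  -- δ₂ = 1/(8p) is half of the gain 1/(4p) from the lowered slope, so equal decay remains on both
  -- sides of J. The growth in J is then γ₁ = δ₂.
  refine ⟨2 * p, 1 / (8 * p), 1 / (8 * p), d / 2 - 1, by linarith, by positivity, ?_, by positivity,
    by linarith, fun φ hφ => ?_⟩
  · rw [critReg]
    have h1 : 1 / (8 * p) < 1 / 8 := by
      rw [div_lt_div_iff₀ (by positivity) (by norm_num)]; linarith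
    have h2 : (d : ℝ) / (2 * p) < 1 / 2 := by
      rw [div_lt_div_iff₀ (by positivity) two_pos]; linarith
    linarith
  obtain ⟨K, hK, hdec⟩ := hφ.exists_decomposition hd hp
  set γ : ℝ := d / 2 - 1 with hγ
  have hγ0 : 0 < γ := by rw [hγ]; linarith
  have h2γ : (1 : ℝ) ≤ 2 ^ γ := Real.one_le_rpow one_le_two hγ0.le
  -- The 1 ensures positivity; 2^γ pays for rounding N down to 2^J in the negative power.
  refine ⟨(K.toReal + 1) * 2 ^ γ, by positivity, fun g hgr hgd hgB N hN => ?_⟩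
  obtain ⟨J, hJ1, hJ2⟩ := exists_mem_Ico_zpow hN one_lt_two
  obtain ⟨gt, gb, hgtr, hgbr, hgtd, hgbd, hg, hgts, hgbs, h1, h2, h3, h4⟩ := hdec g hgr hgd hgB J
  have hM := hgB.1
  set M := besovNorm φ (critReg d p) (ENNReal.ofReal p) ∞ g
  have hKle : K ≤ ENNReal.ofReal (K.toReal + 1) := by
    conv_lhs => rw [← ENNReal.ofReal_toReal hK.ne]
    exact ENNReal.ofReal_le_ofReal (by linarith)
  have hKC : K ≤ ENNReal.ofReal ((K.toReal + 1) * 2 ^ γ) :=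
    hKle.trans (ENNReal.ofReal_le_ofReal (le_mul_of_one_le_right (by positivity) h2γ))
  have hlow : (2 : ℝ) ^ (-(γ * (J : ℝ))) ≤ 2 ^ γ * N ^ (-γ) := by
    have h5 : N ≤ (2 : ℝ) ^ ((J : ℝ) + 1) := by
      rw [← Int.cast_one, ← Int.cast_add, Real.rpow_intCast]; exact hJ2.le
    have h6 := Real.rpow_le_rpow_of_nonpos hN h5 (by linarith : -γ ≤ 0)
    rw [← Real.rpow_mul zero_le_two] at h6
    calc (2 : ℝ) ^ (-(γ * (J : ℝ))) = 2 ^ γ * 2 ^ (((J : ℝ) + 1) * -γ) := by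
          rw [← Real.rpow_add two_pos]
          congr 1
          ring
      _ ≤ _ := by gcongr
  have hhigh : (2 : ℝ) ^ (1 / (8 * p) * (J : ℝ)) ≤ N ^ (1 / (8 * p)) := by
    rw [mul_comm, Real.rpow_mul zero_le_two, Real.rpow_intCast]
    exact Real.rpow_le_rpow (by positivity) hJ1 (by positivity)
  have h1' : distLpNorm 2 gt ≤
      ENNReal.ofReal ((K.toReal + 1) * 2 ^ γ * N ^ (-γ)) * M := by
    refine h1.trans ?_
    gcongr
    rw [mul_assoc, ENNReal.ofReal_mul (by positivity)]
    exact mul_le_mul' hKle (ENNReal.ofReal_le_ofReal hlow)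
  have h2' : besovNorm φ (critReg d (2 * p) + 1 / (8 * p)) (ENNReal.ofReal (2 * p))
      (ENNReal.ofReal (2 * p)) gb ≤
      ENNReal.ofReal ((K.toReal + 1) * 2 ^ γ * N ^ (1 / (8 * p))) * M := by
    refine h2.trans ?_
    gcongr
    rw [ENNReal.ofReal_mul (by positivity)]
    exact mul_le_mul' hKC (ENNReal.ofReal_le_ofReal hhigh)
  have h3' := h3.trans (mul_le_mul_left hKC M)
  have h4' := h4.trans (mul_le_mul_left hKC M)
  exact ⟨gt, gb, hgtr, hgbr, hgtd, hgbd,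
    h1'.trans_lt (ENNReal.mul_lt_top ENNReal.ofReal_lt_top hM),
    ⟨h3'.trans_lt (ENNReal.mul_lt_top ENNReal.ofReal_lt_top hM), hgts⟩,
    ⟨h2'.trans_lt (ENNReal.mul_lt_top ENNReal.ofReal_lt_top hM), hgbs⟩,
    ⟨h4'.trans_lt (ENNReal.mul_lt_top ENNReal.ofReal_lt_top hM), hgbs⟩,
    hg, h1', h2', h3', h4'⟩
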